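/- **Setting.** There are $m$ items and $n$ positions, $1\le n\le m$; a ranking $R$ places distinct items at the positions $1,\dots,n$ and is identified with its $0/1$ assignment matrix in $\mathbb R^{m\times n}$. The positions are partitioned into $q$ nonempty blocks $B_1,\dots,B_q$ of consecutive positions, in this order (block sizes are arbitrary), and $G_1,\dots,G_p\subseteq[m]$ are disjoint groups of items. The discounts satisfy $v_1\ge v_2\ge\dots\ge v_n>0$. Given $L,U\in\mathbb Z^{q\times p}$ and $C,A\in[0,1]^{m\times q}$, a ranking $R$ is *group fair* if $L_{j\ell}\le\sum_{i\in G_\ell}\sum_{t\in B_j}R_{it}\le U_{j\ell}$ for all $j,\ell$, and a distribution $\mathcal D$ over rankings is *fair* if $C_{ij}\le\Pr_{R\sim\mathcal D}[i\text{ is placed in }B_j]\le A_{ij}$ for all $i,j$ and every ranking in its support is group fair. **Utilities.** Given means $\mu\in\mathbb R^m$ and $\sigma_1,\dots,\sigma_m\ge0$, the true utilities $\rho_i\sim\mathcal N(\mu_i,\sigma_i^2)$ are independent; $\sigma_{\max}=\max_i\sigma_i$. Throughout, $A$ is the all-ones matrix and $$C_{ij}=\Pr_\rho\big[\exists\,t\in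 B_j:\ \rho_i\text{ is the }t\text{-th largest of }\rho_1,\dots,\rho_m\big].$$ For each $\rho$, let $\mathcal D^\star=\mathcal D^\star(\rho)$ be a fair distribution that maximizes $\mathbb E_{R\sim\mathcal D}[\rho^\top Rv]$ over all fair distributions $\mathcal D$; thus $\mathcal D^\star$ may depend on the true utilities. **Algorithm 1**, given $(\mu,L,U,A,C,v)$ but not $\rho$: (solve) compute any optimal solution $\widehat D$ of the linear program: maximize $\mu^\top Dv$ over $D\in[0,1]^{m\times n}$ with $\sum_iD_{it}=1$ for all $t$, $\sum_tD_{it}\le1$ for all $i$, and, for all $i,j,\ell$, $C_{ij}\le\sum_{t\in B_j}D_{it}\le A_{ij}$ and $L_{j\ell}\le\sum_{i\in G_\ell}\sum_{t\in B_j}D_{it}\le U_{j\ell}$; (project) put $\widehat M_{ij}=\sum_{t\in B_j}\widehat D_{it}$; (decompose) write $\widehat M=\sum_{t\le T}\alpha_tM_t$ as any convex combination of $0/1$ matrices $M_t$ of matchings (each item is in at most one block, and $B_j$ contains exactly $|B_j|$ items) that satisfy $L_{j\ell}\le\sum_{i\in G_\ell}(M_t)_{ij}\le U_{j\ell}$;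 (refine) let $R_t$ be a ranking that places in each block the items that $M_t$ assigns to it, in non-increasing order of $\mu_i$; output $R_t$ with probability $\alpha_t$. Let $\mathcal D$ be the law of the output. **Theorem.** 1. *(Fairness, and deterministic means.)* There is an absolute constant $K>0$ such that the following holds for all parameters as above and all $\mu\in\mathbb R^m$. If a fair distribution exists, then Algorithm 1 can be run with $T\le K\,n^2m^2$. For every run of Algorithm 1, $\mathcal D$ is a fair distribution; and if the $n$-th largest mean $\mu_{(n)}$ is positive and a $\mathcal D^\star(\rho)$ is given for every $\rho$, then $$\mathbb E_\rho\mathbb E_{R\sim\mathcal D}[\rho^\top Rv]\ \ge\ \alpha\cdot\mathbb E_\rho\mathbb E_{R\sim\mathcal D^\star(\rho)}[\rho^\top Rv],\qquad \alpha=1-K\,\frac{\sigma_{\max}}{\mu_{(n)}}\sqrt{\log m}-K\,m^{-1/4},$$ whenever this $\alpha$ is positive. 2. *(Random means.)* For every $c>0$ there is a $K>0$, depending only on $c$, such that the following holds for all parameters as above with $n\le(1-c)m$ and all $S>0$. Let $\mu_1,\dots,\mu_m$ be i.i.d. uniform on $[0,S]$ and, given $\mu$, let $\rho$ be as above; put $\alpha=1-K\frac{\sigma_{\max}}{S}\sqrt{\log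 m}-K\,m^{-1/4}$. (a) Let $L,U$ be chosen as any functions of $\mu$ (for example constant), such that for almost every $\mu$ the law $\mathcal D_\mu$ is the output law of a run of Algorithm 1 and, for every $\rho$, $\mathcal D^\star_{\mu,\rho}$ is a distribution $\mathcal D^\star(\rho)$ for this instance; assume that $\mathcal D_\mu$ and $\mathcal D^\star_{\mu,\rho}$ depend measurably on $\mu$ and on $(\mu,\rho)$. Then $$\mathbb E_{\mu,\rho}\mathbb E_{R\sim\mathcal D_\mu}[\rho^\top Rv]\ \ge\ \alpha\cdot\mathbb E_{\mu,\rho}\mathbb E_{R\sim\mathcal D^\star_{\mu,\rho}}[\rho^\top Rv].$$ (b) With probability at least $1-K\,m^{-1/4}$ over $\mu$, for all $L,U$, every run of Algorithm 1 and every choice of the distributions $\mathcal D^\star(\rho)$, $$\mathbb E_\rho\mathbb E_{R\sim\mathcal D}[\rho^\top Rv]\ \ge\ \alpha\cdot\mathbb E_\rho\mathbb E_{R\sim\mathcal D^\star(\rho)}[\rho^\top Rv].$$ -/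

import Mathlib

open MeasureTheory ProbabilityTheory
open scoped NNReal

noncomputable section

namespace FairRanking

/-- A ranking of `n` out of `m` items: position `t` holds the item `R t`, and no item is placed
twice. -/
abbrev Ranking (m n : ℕ) := Fin n ↪ Fin m

/-- The 0/1 assignment matrix of a ranking: entry `(i, t)` is `1` iff item `i` is at position
`t`. -/
def assignment {m n : ℕ} (R : Ranking m n) : Matrix (Fin m) (Fin n) ℝ :=
  fun i t => if R t = i then 1 else 0

/-- The bilinear utility `ρᵀ X v`. -/
def utility {m n : ℕ} (ρ : Fin m → ℝ) (v : Fin n → ℝ) (X : Matrix (Fin m) (Fin n) ℝ) : ℝ :=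
  ∑ i, ∑ t, ρ i * X i t * v t

/-- The expected utility of a ranking with law `D`, for item utilities `ρ` and discounts `v`. -/
def expUtility {m n : ℕ} (ρ : Fin m → ℝ) (v : Fin n → ℝ) (D : Ranking m n → ℝ) : ℝ :=
  ∑ R, D R * utility ρ v (assignment R)

/-- The blocks of positions and the protected groups of items. The blocks are the nonempty fibres
of `block`; since `block` is monotone they are consecutive intervals, listed from the top of the
ranking to its bottom, and they cover all the positions. -/
structure Layout (m n p q : ℕ) where
  block : Fin n → Fin q
  block_mono : Monotone block
  block_surj : Function.Surjective block
  group : Fin p → Finset (Fin m)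
  group_disjoint : Pairwise fun k l => Disjoint (group k) (group l)

variable {m n p q : ℕ}

/-- The positions of the block `B_j`. -/
def Layout.positions (lay : Layout m n p q) (j : Fin q) : Finset (Fin n) :=
  Finset.univ.filter fun t => lay.block t = j

/-- The projection `g` to the space of matchings: `g(X)_{ij} = ∑_{t ∈ B_j} X_{it}`. -/
def Layout.proj (lay : Layout m n p q) (X : Matrix (Fin m) (Fin n) ℝ) :
    Matrix (Fin m) (Fin q) ℝ :=
  fun i j => ∑ t ∈ lay.positions j, X i t

/-- The `(L, U)`-group fairness constraints on a matrix with one column for each block. -/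
def GroupFair (lay : Layout m n p q) (L U : Matrix (Fin q) (Fin p) ℤ)
    (M : Matrix (Fin m) (Fin q) ℝ) : Prop :=
  ∀ j l, (L j l : ℝ) ≤ ∑ i ∈ lay.group l, M i j ∧ ∑ i ∈ lay.group l, M i j ≤ (U j l : ℝ)

/-- The `(L, U)`-group fairness constraints on a ranking. -/
def RankingGroupFair (lay : Layout m n p q) (L U : Matrix (Fin q) (Fin p) ℤ)
    (R : Ranking m n) : Prop :=
  GroupFair lay L U (lay.proj (assignment R))

open Classical in
/-- The probability that item `i` appears in block `B_j` under the law `D`. -/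
def blockProb (lay : Layout m n p q) (D : Ranking m n → ℝ) (i : Fin m) (j : Fin q) : ℝ :=
  ∑ R, if ∃ t, lay.block t = j ∧ R t = i then D R else 0

/-- The `(C, A)`-individual fairness constraints on a law over rankings. -/
def IndividuallyFair (lay : Layout m n p q) (C A : Matrix (Fin m) (Fin q) ℝ)
    (D : Ranking m n → ℝ) : Prop :=
  ∀ i j, C i j ≤ blockProb lay D i j ∧ blockProb lay D i j ≤ A i j

/-- `D` is a probability distribution over rankings that satisfies the individual fairness
constraints and each ranking in its support satisfies the group fairness constraints. -/
structure IsFair (lay : Layout m n p q) (L U : Matrix (Fin q) (Fin p) ℤ)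
    (C A : Matrix (Fin m) (Fin q) ℝ) (D : Ranking m n → ℝ) : Prop where
  distribution : D ∈ stdSimplex ℝ (Ranking m n)
  individual : IndividuallyFair lay C A D
  group : ∀ R, D R ≠ 0 → RankingGroupFair lay L U R

/-- `D` is an optimal solution of the fair ranking problem with item utilities `ρ`. -/
def IsOptimalFair (lay : Layout m n p q) (L U : Matrix (Fin q) (Fin p) ℤ)
    (C A : Matrix (Fin m) (Fin q) ℝ) (ρ : Fin m → ℝ) (v : Fin n → ℝ)
    (D : Ranking m n → ℝ) : Prop :=
  IsFair lay L U C A D ∧ ∀ D', IsFair lay L U C A D' → expUtility ρ v D' ≤ expUtility ρ v D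

/-- The feasible region of the linear program for the marginals
`X_{it} = Pr[item i is at position t]`. -/
structure LPFeasible (lay : Layout m n p q) (L U : Matrix (Fin q) (Fin p) ℤ)
    (C A : Matrix (Fin m) (Fin q) ℝ) (X : Matrix (Fin m) (Fin n) ℝ) : Prop where
  mem_unit : ∀ i t, 0 ≤ X i t ∧ X i t ≤ 1
  individual : ∀ i j, C i j ≤ lay.proj X i j ∧ lay.proj X i j ≤ A i j
  position : ∀ t, ∑ i, X i t = 1
  item : ∀ i, ∑ t, X i t ≤ 1
  group : GroupFair lay L U (lay.proj X)

/-- Matrices of matchings: each item is in at most one block, and `B_j` holds `|B_j|` items. -/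
structure IsMatching (lay : Layout m n p q) (M : Matrix (Fin m) (Fin q) ℝ) : Prop where
  zero_one : ∀ i j, M i j = 0 ∨ M i j = 1
  item : ∀ i, ∑ j, M i j ≤ 1
  block : ∀ j, ∑ i, M i j = ((lay.positions j).card : ℝ)

/-- A run of the rounding algorithm on the utilities `u`. The algorithm
* (solve) computes an optimal solution `Dhat` of the linear program,
* (project, decompose) writes `g(Dhat)` as a convex combination of group fair matchings,
* (refine) turns each matching into a ranking that has the same items in each block, and in which
  the items of each block are in non-increasing order of utility,
* returns the `t`-th of these rankings with probability `weight t`.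
Any optimal solution, any decomposition and any way of breaking ties may be used. -/
structure AlgRun (lay : Layout m n p q) (L U : Matrix (Fin q) (Fin p) ℤ)
    (C A : Matrix (Fin m) (Fin q) ℝ) (u : Fin m → ℝ) (v : Fin n → ℝ) where
  Dhat : Matrix (Fin m) (Fin n) ℝ
  feasible : LPFeasible lay L U C A Dhat
  optimal : ∀ X, LPFeasible lay L U C A X → utility u v X ≤ utility u v Dhat
  T : ℕ
  weight : Fin T → ℝ
  weight_nonneg : ∀ t, 0 ≤ weight t
  weight_sum : ∑ t, weight t = 1
  M : Fin T → Matrix (Fin m) (Fin q) ℝ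
  isMatching : ∀ t, IsMatching lay (M t)
  groupFair : ∀ t, GroupFair lay L U (M t)
  decompose : lay.proj Dhat = ∑ t, weight t • M t
  R : Fin T → Ranking m n
  refine_proj : ∀ t, lay.proj (assignment (R t)) = M t
  refine_sorted : ∀ t s s', lay.block s = lay.block s' → s ≤ s' → u (R t s') ≤ u (R t s)

/-- The law of the ranking that a run of the algorithm returns. -/
def AlgRun.law {lay : Layout m n p q} {L U : Matrix (Fin q) (Fin p) ℤ}
    {C A : Matrix (Fin m) (Fin q) ℝ} {u : Fin m → ℝ} {v : Fin n → ℝ}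
    (run : AlgRun lay L U C A u v) : Ranking m n → ℝ :=
  fun R => ∑ t, if run.R t = R then run.weight t else 0

/-- `y` is the `k`-th largest (`k = 1, 2, …`) of the values `x i`, counted with multiplicity: fewer
than `k` of them exceed `y`, and at least `k` of them are at least `y`. -/
def IsKthLargest (x : Fin m → ℝ) (k : ℕ) (y : ℝ) : Prop :=
  (Finset.univ.filter fun i => y < x i).card < k ∧ k ≤ (Finset.univ.filter fun i => y ≤ x i).card

/-- The law of the true utilities: independent with `ρ_i ∼ N(μ_i, σ_i²)` (a point mass if
`σ_i = 0`). -/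
def utilityLaw (μ : Fin m → ℝ) (σ : Fin m → ℝ≥0) : Measure (Fin m → ℝ) :=
  Measure.pi fun i => gaussianReal (μ i) (σ i ^ 2)

/-- The law of i.i.d. means, uniform on `[0, S]`. -/
def meansLaw (m : ℕ) (S : ℝ) : Measure (Fin m → ℝ) :=
  Measure.pi fun _ => cond volume (Set.Icc 0 S)

/-- The rank probabilities: entry `(i, j)` is the probability that `ρ_i` is the `t`-th largest
of the utilities for some position `t` in block `B_j` (positions are numbered from `0` here). -/
def rankProb (lay : Layout m n p q) (μ : Fin m → ℝ) (σ : Fin m → ℝ≥0) :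
    Matrix (Fin m) (Fin q) ℝ :=
  fun i j => (utilityLaw μ σ).real
    {ρ | ∃ t, lay.block t = j ∧ IsKthLargest ρ ((t : ℕ) + 1) (ρ i)}

/-- The matrix of upper bounds with all entries `1`. -/
def allOnes (m q : ℕ) : Matrix (Fin m) (Fin q) ℝ := fun _ _ => 1

/-- `σ_max`, the largest standard deviation. -/
def sigmaMax (σ : Fin m → ℝ≥0) : ℝ := ((Finset.univ.sup σ : ℝ≥0) : ℝ)

/-- `1 - K (σ_max / s) √(log m) - K m^{-1/4}`. -/
def alphaBound (K : ℝ) (σ : Fin m → ℝ≥0) (s : ℝ) : ℝ :=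
  1 - K * (sigmaMax σ / s * Real.sqrt (Real.log m)) - K * (m : ℝ) ^ (-(1 / 4) : ℝ)

end FairRanking

end

open FairRanking

noncomputable section

namespace FairRanking

variable {m n p q : ℕ}

/-! ### Values in decreasing order -/

/-! The lower bounds alone pin down the block marginals. For every `ρ`, sorting exhibits |B_j|
distinct items ranked in block j, so column j of C sums to at least |B_j|; ties can only add to it.
The projection of a feasible matrix dominates C and has column sums exactly |B_j|, so it equals C
(`LPFeasible.proj_eq`). Hence the optimality of the LP solution plays no role in the guarantee:
every run places item i in block j with exactly the probability that the true utility of i ranks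
there. The same rigidity, applied to the mean assignment of a fair distribution, shows that the
projected LP solution is a mixture of group fair matchings, and Carathéodory's theorem bounds the
number of terms (`exists_algRun`).

For the utility, take δ of order σ_max √(log m), so that all deviations |ρ_i - μ_i| are at most δ
except with probability O(m⁻³). When they are, an item ranked in block j has mean at least that of
the last item of the block in the order of means, minus 2δ; and an item that few others can overtake
is ranked in block j or earlier. Because the marginals are C, a random output violates one of these
properties with small probability. A ranking without violations, sorted inside its blocks, has at
each position t a mean within 4δ below the t-th largest (`desc_sub_le_of_sorted`). With B the best
value for the means and V the sum of the discounts, the output is therefore worth nearly B - O(δ)V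
in expectation. Conversely, no distribution, even one knowing `ρ`, is worth more than B + V(δ +
`excess`), by the rearrangement inequality. If the n largest means are at least cs, then B ≥ csV,
and the additive errors become relative ones (`alpha_mul_le_of_bounds`).

For uniform means, Chebyshev's inequality applied to the number of means below cS/2 shows that the n
largest are at least cS/2 with probability 1 - O(1/m). This gives the high probability statement
directly, and bounds the average of B from below for the statement in expectation. -/

/-- A permutation that lists the values of `x` in non-increasing order. -/
def descPerm (x : Fin m → ℝ) : Equiv.Perm (Fin m) := Tuple.sort fun i => -x i

/-- The values of `x` in non-increasing order. -/
def desc (x : Fin m → ℝ) (k : Fin m) : ℝ := x (descPerm x k)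

lemma desc_antitone (x : Fin m → ℝ) : Antitone (desc x) := by
  intro a b hab
  have := Tuple.monotone_sort (fun i => -x i) hab
  simpa [desc, descPerm] using this

lemma card_filter_descPerm (x : Fin m → ℝ) (P : Fin m → Prop) [DecidablePred P] :
    (Finset.univ.filter fun k => P (descPerm x k)).card = (Finset.univ.filter P).card :=
  Finset.card_equiv (descPerm x) (by simp)

lemma le_desc_of_lt_card {x : Fin m → ℝ} {a : ℝ} {k : Fin m}
    (h : (k : ℕ) < (Finset.univ.filter fun i => a ≤ x i).card) : a ≤ desc x k := by
  by_contra! hk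
  rw [← card_filter_descPerm x] at h
  have hsub : (Finset.univ.filter fun i => a ≤ x (descPerm x i)) ⊆ Finset.Iio k := by
    intro i hi
    rw [Finset.mem_filter] at hi
    rw [Finset.mem_Iio]
    by_contra! hki
    exact absurd (hi.2.trans (desc_antitone x hki)) (not_le.mpr hk)
  have := Finset.card_le_card hsub
  rw [Fin.card_Iio] at this
  omega

lemma isKthLargest_desc (x : Fin m → ℝ) (k : Fin m) :
    IsKthLargest x ((k : ℕ) + 1) (x (descPerm x k)) := by
  change IsKthLargest x ((k : ℕ) + 1) (desc x k)
  constructor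
  · rw [← card_filter_descPerm x, Nat.lt_succ_iff, ← Fin.card_Iio k]
    refine Finset.card_le_card fun i hi => ?_
    rw [Finset.mem_filter] at hi
    rw [Finset.mem_Iio]
    by_contra! hki
    exact absurd (desc_antitone x hki) (not_le.mpr hi.2)
  · rw [← card_filter_descPerm x, ← Fin.card_Iic k]
    refine Finset.card_le_card fun i hi => ?_
    rw [Finset.mem_Iic] at hi
    exact Finset.mem_filter.mpr ⟨Finset.mem_univ _, desc_antitone x hi⟩

/-- The rearrangement inequality for rankings. -/
lemma sum_ranking_le_sum_desc (hn : n ≤ m) {v : Fin n → ℝ} (hv : ∀ t, 0 ≤ v t)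
    (hanti : Antitone v) (x : Fin m → ℝ) (R : Ranking m n) :
    ∑ t, x (R t) * v t ≤ ∑ t, desc x (Fin.castLE hn t) * v t := by
  classical
  -- Discounts extended by zero, and the ranking extended to a permutation, reduce the claim to
  -- rearrangement on all m items; the extension stays antitone because the discounts are
  -- nonnegative.
  let w : Fin m → ℝ := fun i => if h : (i : ℕ) < n then v ⟨i, h⟩ else 0
  have hw : Antitone w := by
    intro a b hab
    have hab' : (a : ℕ) ≤ b := hab
    simp only [w]
    split_ifs with h1 h2
    · exact hanti hab'
    · omega
    · exact hv _
    · exact le_rfl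
  have hsum : ∀ f : Fin m → ℝ, ∑ i, f i * w i = ∑ t, f (Fin.castLE hn t) * v t := by
    intro f
    symm
    rw [← Finset.sum_subset (Finset.subset_univ
      (Finset.univ.map (Fin.castLEEmb hn)))]
    · rw [Finset.sum_map]
      refine Finset.sum_congr rfl fun t _ => ?_
      simp [w]
    · intro i _ hi
      have : ¬ (i : ℕ) < n := by
        intro h
        exact hi (by simpa using ⟨⟨i, h⟩, rfl⟩)
      simp [w, this]
  obtain ⟨e, he⟩ : ∃ e : Equiv.Perm (Fin m), ∀ t, e (Fin.castLE hn t) = R t := by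
    let f : Set.range (Fin.castLE hn) ≃ Set.range R :=
      (Equiv.ofInjective _ (Fin.castLE_injective hn)).symm.trans (Equiv.ofInjective _ R.injective)
    refine ⟨f.extendSubtype, fun t => ?_⟩
    rw [Equiv.extendSubtype_apply_of_mem _ _ ⟨t, rfl⟩]
    simp [f]
  have hmono : Monovary (desc x) w := (desc_antitone x).monovary hw
  have key := hmono.sum_comp_perm_mul_le_sum_mul (σ := e.trans (descPerm x).symm)
  rw [hsum, hsum] at key
  refine le_trans (le_of_eq ?_) key
  refine Finset.sum_congr rfl fun t _ => ?_
  simp [desc, he]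

/-! ### Assignment matrices and laws -/

lemma utility_assignment (ρ : Fin m → ℝ) (v : Fin n → ℝ) (R : Ranking m n) :
    utility ρ v (assignment R) = ∑ t, ρ (R t) * v t := by
  unfold utility assignment
  rw [Finset.sum_comm]
  simp

lemma proj_assignment_eq_one {lay : Layout m n p q} {R : Ranking m n} {i : Fin m} {j : Fin q}
    (h : ∃ t, lay.block t = j ∧ R t = i) : lay.proj (assignment R) i j = 1 := by
  obtain ⟨t, ht, rfl⟩ := h
  have : ∀ s, (R s = R t) ↔ s = t := fun s => R.injective.eq_iff
  simp [Layout.proj, assignment, Layout.positions, this, ht]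

lemma proj_assignment_eq_zero {lay : Layout m n p q} {R : Ranking m n} {i : Fin m} {j : Fin q}
    (h : ¬ ∃ t, lay.block t = j ∧ R t = i) : lay.proj (assignment R) i j = 0 := by
  push Not at h
  refine Finset.sum_eq_zero fun t ht => ?_
  simp only [Layout.positions, Finset.mem_filter] at ht
  simp [assignment, h t ht.2]

lemma proj_assignment_nonneg (lay : Layout m n p q) (R : Ranking m n) (i : Fin m) (j : Fin q) :
    0 ≤ lay.proj (assignment R) i j := by
  by_cases h : ∃ t, lay.block t = j ∧ R t = i
  · rw [proj_assignment_eq_one h]; exact zero_le_one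
  · rw [proj_assignment_eq_zero h]

lemma sum_proj_le (lay : Layout m n p q) {X : Matrix (Fin m) (Fin n) ℝ} (hX : ∀ i t, 0 ≤ X i t)
    (i : Fin m) (s : Finset (Fin q)) : ∑ j ∈ s, lay.proj X i j ≤ ∑ t, X i t := by
  classical
  calc ∑ j ∈ s, lay.proj X i j ≤ ∑ j, lay.proj X i j :=
        Finset.sum_le_univ_sum_of_nonneg fun j => Finset.sum_nonneg fun t _ => hX i t
    _ = ∑ t, X i t := Finset.sum_fiberwise Finset.univ lay.block (fun t => X i t)

lemma sum_proj_eq (lay : Layout m n p q) (X : Matrix (Fin m) (Fin n) ℝ) (j : Fin q) :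
    ∑ i, lay.proj X i j = ∑ t ∈ lay.positions j, ∑ i, X i t :=
  Finset.sum_comm

lemma sum_assignment_le_one (R : Ranking m n) (i : Fin m) : ∑ t, assignment R i t ≤ 1 := by
  classical
  unfold assignment
  rw [Finset.sum_boole]
  have : (Finset.univ.filter fun t => R t = i).card ≤ 1 :=
    Finset.card_le_one.mpr fun a ha b hb => R.injective (by simp_all)
  exact_mod_cast this

lemma assignment_nonneg (R : Ranking m n) (i : Fin m) (t : Fin n) : 0 ≤ assignment R i t := by
  unfold assignment; split_ifs <;> simp

lemma isMatching_proj_assignment (lay : Layout m n p q) (R : Ranking m n) :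
    IsMatching lay (lay.proj (assignment R)) where
  zero_one i j := by
    by_cases h : ∃ t, lay.block t = j ∧ R t = i
    · exact Or.inr (proj_assignment_eq_one h)
    · exact Or.inl (proj_assignment_eq_zero h)
  item i := (sum_proj_le lay (assignment_nonneg R) i _).trans (sum_assignment_le_one R i)
  block j := by
    rw [sum_proj_eq]
    simp [assignment]

lemma blockProb_eq (lay : Layout m n p q) (D : Ranking m n → ℝ) (i : Fin m) (j : Fin q) :
    blockProb lay D i j = ∑ R, D R * lay.proj (assignment R) i j := by
  classical
  unfold blockProb
  refine Finset.sum_congr rfl fun R _ => ?_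
  split_ifs with h
  · rw [proj_assignment_eq_one h, mul_one]
  · rw [proj_assignment_eq_zero h, mul_zero]

lemma AlgRun.sum_law_mul {lay : Layout m n p q} {L U : Matrix (Fin q) (Fin p) ℤ}
    {C A : Matrix (Fin m) (Fin q) ℝ} {u : Fin m → ℝ} {v : Fin n → ℝ}
    (run : AlgRun lay L U C A u v) (f : Ranking m n → ℝ) :
    ∑ R, run.law R * f R = ∑ k, run.weight k * f (run.R k) := by
  classical
  simp only [AlgRun.law, Finset.sum_mul]
  rw [Finset.sum_comm]
  refine Finset.sum_congr rfl fun k _ => ?_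
  rw [Finset.sum_eq_single (run.R k)] <;> simp +contextual [eq_comm]

lemma AlgRun.isFair_law {lay : Layout m n p q} {L U : Matrix (Fin q) (Fin p) ℤ}
    {C A : Matrix (Fin m) (Fin q) ℝ} {u : Fin m → ℝ} {v : Fin n → ℝ}
    (run : AlgRun lay L U C A u v) : IsFair lay L U C A run.law where
  distribution := by
    refine ⟨fun R => Finset.sum_nonneg fun k _ => ?_, ?_⟩
    · split_ifs
      · exact run.weight_nonneg k
      · exact le_rfl
    · simpa [run.weight_sum] using run.sum_law_mul fun _ => 1
  individual i j := by
    have : blockProb lay run.law i j = lay.proj run.Dhat i j := by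
      rw [blockProb_eq, run.sum_law_mul, run.decompose, Matrix.sum_apply]
      simp [run.refine_proj]
    rw [this]
    exact run.feasible.individual i j
  group R hR := by
    obtain ⟨k, -, hk⟩ := Finset.exists_ne_zero_of_sum_ne_zero hR
    have hk' : run.R k = R := by
      by_contra h
      simp [h] at hk
    unfold RankingGroupFair
    rw [← hk', run.refine_proj]
    exact run.groupFair k

/-! ### Positions of a block -/

lemma Layout.positions_nonempty (lay : Layout m n p q) (j : Fin q) : (lay.positions j).Nonempty := by
  obtain ⟨t, ht⟩ := lay.block_surj j
  exact ⟨t, by simp [Layout.positions, ht]⟩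

/-- The last position of a block. -/
def Layout.last (lay : Layout m n p q) (j : Fin q) : Fin n :=
  (lay.positions j).max' (lay.positions_nonempty j)

lemma Layout.block_last (lay : Layout m n p q) (j : Fin q) : lay.block (lay.last j) = j :=
  (Finset.mem_filter.mp ((lay.positions j).max'_mem (lay.positions_nonempty j))).2

lemma Layout.block_le_iff (lay : Layout m n p q) (t : Fin n) (j : Fin q) :
    lay.block t ≤ j ↔ t ≤ lay.last j := by
  constructor
  · intro h
    by_contra! hlt
    have h2 := lay.block_mono hlt.le
    rw [lay.block_last] at h2
    exact absurd ((lay.positions j).le_max' t (by simp [Layout.positions, le_antisymm h h2]))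
      (not_le.mpr hlt)
  · intro h
    simpa [lay.block_last] using lay.block_mono h

lemma Layout.card_blocks_le (lay : Layout m n p q) : q ≤ n := by
  simpa using Fintype.card_le_of_surjective _ lay.block_surj

/-! ### Rank probabilities -/

instance (μ : Fin m → ℝ) (σ : Fin m → ℝ≥0) : IsProbabilityMeasure (utilityLaw μ σ) := by
  unfold utilityLaw; infer_instance

/-- The event that item `i` is ranked in the block `j` by the utilities. -/
def rankEvent (lay : Layout m n p q) (i : Fin m) (j : Fin q) : Set (Fin m → ℝ) :=
  {ρ | ∃ t, lay.block t = j ∧ IsKthLargest ρ ((t : ℕ) + 1) (ρ i)}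

lemma measurableSet_rankEvent (lay : Layout m n p q) (i : Fin m) (j : Fin q) :
    MeasurableSet (rankEvent lay i j) := by
  classical
  have h1 : Measurable fun ρ : Fin m → ℝ => (Finset.univ.filter fun l => ρ i < ρ l).card := by
    simp only [Finset.card_filter]
    refine Finset.measurable_sum _ fun l _ => Measurable.ite ?_ measurable_const measurable_const
    exact measurableSet_lt (measurable_pi_apply i) (measurable_pi_apply l)
  have h2 : Measurable fun ρ : Fin m → ℝ => (Finset.univ.filter fun l => ρ i ≤ ρ l).card := by
    simp only [Finset.card_filter]
    refine Finset.measurable_sum _ fun l _ => Measurable.ite ?_ measurable_const measurable_const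
    exact measurableSet_le (measurable_pi_apply i) (measurable_pi_apply l)
  have : rankEvent lay i j = ⋃ t, {ρ | lay.block t = j} ∩
      ({ρ : Fin m → ℝ | (Finset.univ.filter fun l => ρ i < ρ l).card < (t : ℕ) + 1} ∩
        {ρ : Fin m → ℝ | (t : ℕ) + 1 ≤ (Finset.univ.filter fun l => ρ i ≤ ρ l).card}) := by
    ext ρ
    simp [rankEvent, IsKthLargest]
  rw [this]
  refine MeasurableSet.iUnion fun t => (MeasurableSet.const _).inter (MeasurableSet.inter ?_ ?_)
  · exact measurableSet_lt h1 measurable_const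
  · exact measurableSet_le measurable_const h2

lemma rankProb_eq (lay : Layout m n p q) (μ : Fin m → ℝ) (σ : Fin m → ℝ≥0) (i : Fin m)
    (j : Fin q) : rankProb lay μ σ i j = (utilityLaw μ σ).real (rankEvent lay i j) := rfl

/-- The column sum is the expected number of items ranked in the block. The items that `descPerm`
puts at the positions of the block are distinct and all qualify. Tied utilities may qualify more
items, hence an inequality. -/
lemma card_positions_le_sum_rankProb (hn : n ≤ m) (lay : Layout m n p q) (μ : Fin m → ℝ)
    (σ : Fin m → ℝ≥0) (j : Fin q) :
    ((lay.positions j).card : ℝ) ≤ ∑ i, rankProb lay μ σ i j := by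
  classical
  have hint : ∀ i ∈ Finset.univ, Integrable ((rankEvent lay i j).indicator fun _ => (1 : ℝ))
      (utilityLaw μ σ) := fun i _ =>
    (integrable_const 1).indicator (measurableSet_rankEvent lay i j)
  have h1 : ∑ i, rankProb lay μ σ i j = ∫ ρ, ∑ i, (rankEvent lay i j).indicator (fun _ => (1 : ℝ)) ρ
      ∂(utilityLaw μ σ) := by
    rw [integral_finsetSum _ hint]
    refine Finset.sum_congr rfl fun i _ => ?_
    rw [integral_indicator_const _ (measurableSet_rankEvent lay i j), rankProb_eq]
    simp
  rw [h1]
  have h2 : ∫ _ρ, ((lay.positions j).card : ℝ) ∂(utilityLaw μ σ) = (lay.positions j).card := by simp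
  rw [← h2]
  refine integral_mono (integrable_const _) (integrable_finsetSum _ hint) fun ρ => ?_
  simp only [Set.indicator_apply]
  rw [Finset.sum_boole]
  norm_cast
  refine Finset.card_le_card_of_injOn (fun t => descPerm ρ (Fin.castLE hn t)) ?_ ?_
  · intro t ht
    simp only [Layout.positions, Finset.coe_filter, Finset.mem_univ, true_and, Set.mem_ofPred_eq]
      at ht ⊢
    exact ⟨t, ht, isKthLargest_desc ρ _⟩
  · intro a _ b _ hab
    exact Fin.castLE_injective hn ((descPerm ρ).injective hab)

/-- Entrywise domination together with column sums in the opposite order leaves no slack. This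
rigidity makes the marginals of every run known exactly. -/
lemma LPFeasible.proj_eq (hn : n ≤ m) {lay : Layout m n p q} {L U : Matrix (Fin q) (Fin p) ℤ}
    {A : Matrix (Fin m) (Fin q) ℝ} {μ : Fin m → ℝ} {σ : Fin m → ℝ≥0}
    {X : Matrix (Fin m) (Fin n) ℝ} (hX : LPFeasible lay L U (rankProb lay μ σ) A X) :
    lay.proj X = rankProb lay μ σ := by
  ext i j
  have hsum : ∑ i, lay.proj X i j = (lay.positions j).card := by
    rw [sum_proj_eq]
    simp [hX.position]
  have hle := card_positions_le_sum_rankProb hn lay μ σ j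
  have h := (Finset.sum_eq_sum_iff_of_le fun i _ => (hX.individual i j).1).mp
    (le_antisymm (Finset.sum_le_sum fun i _ => (hX.individual i j).1) (hsum.trans_le hle))
  exact (h i (Finset.mem_univ i)).symm

/-! ### Existence of a run -/

lemma IsFair.lpFeasible {lay : Layout m n p q} {L U : Matrix (Fin q) (Fin p) ℤ}
    {C A : Matrix (Fin m) (Fin q) ℝ} {D : Ranking m n → ℝ} (hD : IsFair lay L U C A D) :
    LPFeasible lay L U C A (∑ R, D R • assignment R) ∧
      lay.proj (∑ R, D R • assignment R) = ∑ R, D R • lay.proj (assignment R) := by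
  obtain ⟨hD0, hD1⟩ := hD.distribution
  have happ : ∀ i t, (∑ R, D R • assignment R) i t = ∑ R, D R * assignment R i t := by
    intro i t
    simp [Matrix.sum_apply]
  have hproj : ∀ i j, lay.proj (∑ R, D R • assignment R) i j =
      ∑ R, D R * lay.proj (assignment R) i j := by
    intro i j
    simp only [Layout.proj, happ, Finset.mul_sum]
    rw [Finset.sum_comm]
  have hitem : ∀ i, ∑ t, (∑ R, D R • assignment R) i t ≤ 1 := by
    intro i
    simp only [happ]
    rw [Finset.sum_comm, ← hD1]
    refine Finset.sum_le_sum fun R _ => ?_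
    rw [← Finset.mul_sum]
    exact mul_le_of_le_one_right (hD0 R) (sum_assignment_le_one R i)
  have hnonneg : ∀ i t, 0 ≤ (∑ R, D R • assignment R) i t := by
    intro i t
    rw [happ]
    exact Finset.sum_nonneg fun R _ => mul_nonneg (hD0 R) (assignment_nonneg R i t)
  refine ⟨⟨fun i t => ⟨hnonneg i t, ?_⟩, ?_, ?_, hitem, ?_⟩, ?_⟩
  · exact (Finset.single_le_sum (fun t _ => hnonneg i t) (Finset.mem_univ t)).trans (hitem i)
  · intro i j
    rw [hproj, ← blockProb_eq]
    exact hD.individual i j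
  · intro t
    simp only [happ]
    rw [Finset.sum_comm, ← hD1]
    refine Finset.sum_congr rfl fun R _ => ?_
    rw [← Finset.mul_sum]
    simp [assignment]
  · intro j l
    have hswap : ∑ i ∈ lay.group l, lay.proj (∑ R, D R • assignment R) i j =
        ∑ R, D R * ∑ i ∈ lay.group l, lay.proj (assignment R) i j := by
      simp only [hproj, Finset.mul_sum]
      rw [Finset.sum_comm]
    rw [hswap]
    have hlow : (L j l : ℝ) = ∑ R, D R * (L j l : ℝ) := by rw [← Finset.sum_mul, hD1, one_mul]
    have hup : (U j l : ℝ) = ∑ R, D R * (U j l : ℝ) := by rw [← Finset.sum_mul, hD1, one_mul]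
    rw [hlow, hup]
    constructor <;> refine Finset.sum_le_sum fun R _ => ?_ <;> by_cases hR : D R = 0
    · simp [hR]
    · exact mul_le_mul_of_nonneg_left (hD.group R hR j l).1 (hD0 R)
    · simp [hR]
    · exact mul_le_mul_of_nonneg_left (hD.group R hR j l).2 (hD0 R)
  · ext i j
    rw [hproj]
    simp [Matrix.sum_apply]

lemma isCompact_lpFeasible (lay : Layout m n p q) (L U : Matrix (Fin q) (Fin p) ℤ)
    (C A : Matrix (Fin m) (Fin q) ℝ) : IsCompact {X | LPFeasible lay L U C A X} := by
  have hbox : IsCompact (Set.univ.pi fun _ : Fin m => Set.univ.pi fun _ : Fin n =>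
      Set.Icc (0 : ℝ) 1) :=
    isCompact_univ_pi fun _ => isCompact_univ_pi fun _ => isCompact_Icc
  refine IsCompact.of_isClosed_subset hbox ?_ fun X hX =>
    fun i _ t _ => hX.mem_unit i t
  have hentry : ∀ i t, Continuous fun X : Matrix (Fin m) (Fin n) ℝ => X i t := fun i t =>
    continuous_id.matrix_elem i t
  have hproj : ∀ i j, Continuous fun X : Matrix (Fin m) (Fin n) ℝ => lay.proj X i j := fun i j =>
    continuous_finsetSum _ fun t _ => hentry i t
  have : {X | LPFeasible lay L U C A X} =
      {X | ∀ i t, 0 ≤ X i t ∧ X i t ≤ 1} ∩ {X | ∀ i j, C i j ≤ lay.proj X i j ∧ lay.proj X i j ≤ A i j} ∩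
      {X | ∀ t, ∑ i, X i t = 1} ∩ {X | ∀ i, ∑ t, X i t ≤ 1} ∩ {X | GroupFair lay L U (lay.proj X)} := by
    ext X
    exact ⟨fun h => ⟨⟨⟨⟨h.1, h.2⟩, h.3⟩, h.4⟩, h.5⟩, fun h => ⟨h.1.1.1.1, h.1.1.1.2, h.1.1.2, h.1.2, h.2⟩⟩
  rw [this]
  unfold GroupFair
  simp only [Set.ofPred_forall, Set.ofPred_and]
  refine ((((isClosed_iInter fun i => isClosed_iInter fun t => ?_).inter
    (isClosed_iInter fun i => isClosed_iInter fun j => ?_)).inter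
    (isClosed_iInter fun t => ?_)).inter (isClosed_iInter fun i => ?_)).inter
    (isClosed_iInter fun j => isClosed_iInter fun l => ?_)
  · exact (isClosed_le continuous_const (hentry i t)).inter
      (isClosed_le (hentry i t) continuous_const)
  · exact (isClosed_le continuous_const (hproj i j)).inter
      (isClosed_le (hproj i j) continuous_const)
  · exact isClosed_eq (continuous_finsetSum _ fun i _ => hentry i t) continuous_const
  · exact isClosed_le (continuous_finsetSum _ fun t _ => hentry i t) continuous_const
  · have := continuous_finsetSum (lay.group l) fun i _ => hproj i j
    exact (isClosed_le continuous_const this).inter (isClosed_le this continuous_const)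

/-- Sorting positions lexicographically by block and then by decreasing utility does the refinement.
The blocks are already in order, so uniqueness of sorted rearrangements shows that the sort never
moves a position to another block. -/
lemma exists_sorted_ranking (lay : Layout m n p q) (u : Fin m → ℝ) (R : Ranking m n) :
    ∃ R' : Ranking m n, lay.proj (assignment R') = lay.proj (assignment R) ∧
      ∀ s s', lay.block s = lay.block s' → s ≤ s' → u (R' s') ≤ u (R' s) := by
  classical
  let f : Fin n → Fin q ×ₗ ℝ := fun t => toLex (lay.block t, -u (R t))
  let e := Tuple.sort f
  have hf : Monotone (f ∘ e) := Tuple.monotone_sort f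
  have hblock : ∀ t, lay.block (e t) = lay.block t := by
    have h1 : Monotone (lay.block ∘ e) := fun a b hab => by
      rcases (Prod.Lex.toLex_le_toLex.mp (hf hab)) with h | h
      · exact h.le
      · exact h.1.le
    have h2 : Monotone (lay.block ∘ (1 : Equiv.Perm (Fin n))) := lay.block_mono
    intro t
    exact congrFun (Tuple.unique_monotone h1 h2) t
  refine ⟨e.toEmbedding.trans R, ?_, ?_⟩
  · ext i j
    simp only [Layout.proj, Layout.positions, assignment]
    refine Finset.sum_equiv e (fun t => ?_) fun t _ => ?_
    · simp [hblock]
    · simp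
  · intro s s' hs hle
    rcases (Prod.Lex.toLex_le_toLex.mp (hf hle)) with h | h
    · exact absurd h (by simp [hblock, hs])
    · simpa using h.2

lemma exists_algRun (hn : n ≤ m) {lay : Layout m n p q} {L U : Matrix (Fin q) (Fin p) ℤ}
    {A : Matrix (Fin m) (Fin q) ℝ} {μ : Fin m → ℝ} {σ : Fin m → ℝ≥0} {D : Ranking m n → ℝ}
    (v : Fin n → ℝ) (hD : IsFair lay L U (rankProb lay μ σ) A D) :
    ∃ run : AlgRun lay L U (rankProb lay μ σ) A μ v, run.T ≤ m * q + 1 := by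
  classical
  obtain ⟨hfeas, hDproj⟩ := hD.lpFeasible
  have hcont : Continuous fun X : Matrix (Fin m) (Fin n) ℝ => utility μ v X := by
    unfold utility
    refine continuous_finsetSum _ fun i _ => continuous_finsetSum _ fun t _ => ?_
    exact (continuous_const.mul (continuous_id.matrix_elem i t)).mul continuous_const
  obtain ⟨X, hX, hopt⟩ := (isCompact_lpFeasible lay L U (rankProb lay μ σ) A).exists_isMaxOn
    ⟨_, hfeas⟩ hcont.continuousOn
  have hmem : lay.proj X ∈ convexHull ℝ
      {M | ∃ R : Ranking m n, D R ≠ 0 ∧ lay.proj (assignment R) = M} := by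
    -- The optimal `X` and the mean assignment of `D` project to the same matrix, so `D` itself
    -- supplies the decomposition of `lay.proj X`.
    rw [LPFeasible.proj_eq hn hX, ← LPFeasible.proj_eq hn hfeas, hDproj]
    obtain ⟨hD0, hD1⟩ := hD.distribution
    have hfilter : ∑ R ∈ Finset.univ.filter (fun R => D R ≠ 0), D R = 1 := by
      rw [Finset.sum_filter_ne_zero, hD1]
    have hfilter' : ∑ R ∈ Finset.univ.filter (fun R => D R ≠ 0), D R • lay.proj (assignment R) =
        ∑ R, D R • lay.proj (assignment R) := by
      refine Finset.sum_filter_of_ne fun R _ h hR => h (by simp [hR])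
    rw [← hfilter']
    refine (convex_convexHull ℝ _).sum_mem (fun R _ => hD0 R) hfilter fun R hR => ?_
    exact subset_convexHull ℝ _ ⟨R, (Finset.mem_filter.mp hR).2, rfl⟩
  -- Carathéodory: affinely independent points in a space of dimension mq number at most mq + 1.
  obtain ⟨ι, _, z, w, hz, haff, hw, hw1, hsum⟩ := eq_pos_convex_span_of_mem_convexHull hmem
  have hcard : Fintype.card ι ≤ m * q + 1 := by
    refine haff.card_le_finrank_succ.trans ?_
    have := Submodule.finrank_le (vectorSpan ℝ (Set.range z))
    rw [Module.finrank_matrix] at this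
    simpa using this
  have hz' : ∀ k, ∃ R : Ranking m n, D R ≠ 0 ∧ lay.proj (assignment R) = z k := fun k =>
    hz ⟨k, rfl⟩
  choose R₀ hR₀ hzR using hz'
  choose R₁ hproj hsorted using fun k => exists_sorted_ranking lay μ (R₀ k)
  let e := Fintype.equivFin ι
  exact ⟨{
    Dhat := X
    feasible := hX
    optimal := fun Y hY => hopt hY
    T := Fintype.card ι
    weight := fun t => w (e.symm t)
    weight_nonneg := fun t => (hw _).le
    weight_sum := by rw [← hw1]; exact Equiv.sum_comp e.symm w
    M := fun t => z (e.symm t)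
    isMatching := fun t => by rw [← hzR]; exact isMatching_proj_assignment lay _
    groupFair := fun t => by rw [← hzR]; exact hD.group _ (hR₀ _)
    decompose := by rw [← hsum]; exact (Equiv.sum_comp e.symm fun k => w k • z k).symm
    R := fun t => R₁ (e.symm t)
    refine_proj := fun t => by rw [hproj, hzR]
    refine_sorted := fun t => hsorted _ }, hcard⟩

/-! ### Rankings close to the order of the means -/

/-- Too few items exceed `ρ i` to include all those that the means put at or above the end of the
block, so one of these has utility at most `ρ i`. Passing from utilities to means costs `z` twice.
-/
lemma desc_le_of_mem_rankEvent (hn : n ≤ m) {lay : Layout m n p q} {i : Fin m} {j : Fin q}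
    {ρ μ : Fin m → ℝ} {z : ℝ} (h : ρ ∈ rankEvent lay i j) (hz : ∀ l, |ρ l - μ l| ≤ z) :
    desc μ (Fin.castLE hn (lay.last j)) ≤ μ i + 2 * z := by
  obtain ⟨t, ht, hlt, -⟩ := h
  have hte : t ≤ lay.last j := (lay.block_le_iff t j).mp ht.le
  obtain ⟨k, hk, hki⟩ : ∃ k ∈ Finset.Iic (Fin.castLE hn (lay.last j)),
      ρ (descPerm μ k) ≤ ρ i := by
    by_contra! hcon
    have hsub : (Finset.Iic (Fin.castLE hn (lay.last j))) ⊆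
        Finset.univ.filter fun k => ρ i < ρ (descPerm μ k) := fun k hk => by
      simpa using hcon k hk
    have hcard := Finset.card_le_card hsub
    rw [card_filter_descPerm μ fun l => ρ i < ρ l, Fin.card_Iic] at hcard
    have : (t : ℕ) ≤ lay.last j := hte
    simp only [Fin.val_castLE] at hcard
    omega
  have h1 : desc μ (Fin.castLE hn (lay.last j)) ≤ μ (descPerm μ k) :=
    desc_antitone μ (Finset.mem_Iic.mp hk)
  have h2 := abs_le.mp (hz (descPerm μ k))
  have h3 := abs_le.mp (hz i)
  linarith [h2.1, h3.2]

lemma lt_card_of_forall_notMem_rankEvent {lay : Layout m n p q} {i : Fin m} {j : Fin q}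
    {ρ μ : Fin m → ℝ} {z : ℝ} (h : ∀ j' ≤ j, ρ ∉ rankEvent lay i j')
    (hz : ∀ l, |ρ l - μ l| ≤ z) :
    (lay.last j : ℕ) + 1 < (Finset.univ.filter fun l => μ i - 2 * z ≤ μ l).card := by
  have hsucc : (Finset.univ.filter fun l => ρ i < ρ l).card + 1 ≤
      (Finset.univ.filter fun l => ρ i ≤ ρ l).card := by
    refine Finset.card_lt_card (Finset.ssubset_iff_of_subset ?_ |>.mpr ⟨i, by simp, by simp⟩)
    exact Finset.monotone_filter_right _ fun l _ hl => le_of_lt hl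
  have hcard : (lay.last j : ℕ) < (Finset.univ.filter fun l => ρ i < ρ l).card := by
    by_contra! hle
    -- With positions numbered from 0, the number of items strictly above `i` is itself a position
    -- at which `i` is ranked, even under ties.
    let t : Fin n := ⟨(Finset.univ.filter fun l => ρ i < ρ l).card,
      lt_of_le_of_lt hle (lay.last j).isLt⟩
    have ht : lay.block t ≤ j := (lay.block_le_iff t j).mpr hle
    exact h _ ht ⟨t, rfl, Nat.lt_succ_self _, hsucc⟩
  have hsub : (Finset.univ.filter fun l => ρ i ≤ ρ l) ⊆
      Finset.univ.filter fun l => μ i - 2 * z ≤ μ l := by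
    refine Finset.monotone_filter_right _ fun l _ hl => ?_
    have hl' : ρ i ≤ ρ l := hl
    change μ i - 2 * z ≤ μ l
    linarith [(abs_le.mp (hz i)).1, (abs_le.mp (hz l)).2]
  have := Finset.card_le_card hsub
  omega

/-- If many means lie above the t-th largest minus 2δ, then the mean at the end of the block is that
close to it, and `hlow` loses another 2δ. Otherwise `hhigh` forces the t + 1 top items into the
blocks up to that of t; by pigeonhole one of them sits at t or later, hence in the same block, and
sortedness finishes without loss. -/
lemma desc_sub_le_of_sorted (hn : n ≤ m) {lay : Layout m n p q} {μ : Fin m → ℝ} {δ : ℝ}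
    (hδ : 0 ≤ δ) {R : Ranking m n}
    (hsorted : ∀ s s', lay.block s = lay.block s' → s ≤ s' → μ (R s') ≤ μ (R s))
    (hlow : ∀ t, desc μ (Fin.castLE hn (lay.last (lay.block t))) - 2 * δ ≤ μ (R t))
    (hhigh : ∀ i j, (Finset.univ.filter fun l => μ i - 2 * δ ≤ μ l).card ≤ (lay.last j : ℕ) + 1 →
      ∃ s, lay.block s ≤ j ∧ R s = i) (t : Fin n) :
    desc μ (Fin.castLE hn t) - 4 * δ ≤ μ (R t) := by
  set e := lay.last (lay.block t) with he
  by_cases hcnt : (Finset.univ.filter fun l => desc μ (Fin.castLE hn t) - 2 * δ ≤ μ l).card ≤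
      (e : ℕ) + 1
  · have hplace : ∀ k : Fin m, k ≤ Fin.castLE hn t →
        ∃ s, lay.block s ≤ lay.block t ∧ R s = descPerm μ k := by
      intro k hk
      refine hhigh _ _ (le_trans (Finset.card_le_card ?_) hcnt)
      refine Finset.monotone_filter_right _ fun l _ hl => ?_
      have hl' : desc μ k - 2 * δ ≤ μ l := hl
      exact (sub_le_sub_right (desc_antitone μ hk) _).trans hl'
    have : Nonempty (Fin n) := ⟨t⟩
    choose! pos hpos hRpos using hplace
    obtain ⟨k, hk, hkt⟩ : ∃ k ∈ Finset.Iic (Fin.castLE hn t), t ≤ pos k := by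
      by_contra! hcon
      have := Finset.card_le_card_of_injOn (s := Finset.Iic (Fin.castLE hn t)) (t := Finset.Iio t)
        pos (fun k hk => by simpa using hcon k (by simpa using hk)) (fun a ha b hb hab => by
          have ha' := hRpos a (by simpa using ha)
          have hb' := hRpos b (by simpa using hb)
          rw [hab, hb'] at ha'
          exact ((descPerm μ).injective ha').symm)
      rw [Fin.card_Iic, Fin.card_Iio] at this
      simp only [Fin.val_castLE] at this
      omega
    have hk' := Finset.mem_Iic.mp hk
    have hblock := le_antisymm (lay.block_mono hkt) (hpos k hk')
    have h1 := hsorted t (pos k) hblock hkt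
    have h2 : desc μ (Fin.castLE hn t) ≤ desc μ k := desc_antitone μ hk'
    rw [hRpos k hk'] at h1
    change desc μ k ≤ μ (R t) at h1
    linarith
  · rw [← card_filter_descPerm μ fun l => desc μ (Fin.castLE hn t) - 2 * δ ≤ μ l] at hcnt
    obtain ⟨k, hk, hke⟩ : ∃ k, desc μ (Fin.castLE hn t) - 2 * δ ≤ desc μ k ∧
        Fin.castLE hn e < k := by
      by_contra! hcon
      refine hcnt ?_
      rw [show (e : ℕ) + 1 = (Finset.Iic (Fin.castLE hn e)).card by simp]
      refine Finset.card_le_card fun k hk => ?_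
      exact Finset.mem_Iic.mpr (hcon k (Finset.mem_filter.mp hk).2)
    have h1 := desc_antitone μ hke.le
    have h2 := hlow t
    rw [← he] at h2
    linarith

/-! ### Deviations of the utilities from their means -/

/-- The total excess over `δ` of the deviations of the utilities from their means. -/
def excess (μ : Fin m → ℝ) (δ : ℝ) (ρ : Fin m → ℝ) : ℝ := ∑ i, max (|ρ i - μ i| - δ) 0

lemma excess_nonneg (μ : Fin m → ℝ) (δ : ℝ) (ρ : Fin m → ℝ) : 0 ≤ excess μ δ ρ :=
  Finset.sum_nonneg fun _ _ => le_max_right _ _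

lemma abs_sub_le_add_excess (μ : Fin m → ℝ) (δ : ℝ) (ρ : Fin m → ℝ) (i : Fin m) :
    |ρ i - μ i| ≤ δ + excess μ δ ρ := by
  have h1 : max (|ρ i - μ i| - δ) 0 ≤ excess μ δ ρ :=
    Finset.single_le_sum (f := fun i => max (|ρ i - μ i| - δ) 0)
      (fun _ _ => le_max_right _ _) (Finset.mem_univ i)
  linarith [le_max_left (|ρ i - μ i| - δ) 0]

/-- The amount by which the mean of item `i` is more than `2 δ` below that of the last item of
block `j` in the order of the means. -/
def shortfall (hn : n ≤ m) (lay : Layout m n p q) (μ : Fin m → ℝ) (δ : ℝ) (i : Fin m)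
    (j : Fin q) : ℝ :=
  max (desc μ (Fin.castLE hn (lay.last j)) - 2 * δ - μ i) 0

lemma shortfall_le (hn : n ≤ m) {lay : Layout m n p q} {μ ρ : Fin m → ℝ} (δ : ℝ) {i : Fin m}
    {j : Fin q} (h : ρ ∈ rankEvent lay i j) : shortfall hn lay μ δ i j ≤ 2 * excess μ δ ρ := by
  have := desc_le_of_mem_rankEvent hn h (abs_sub_le_add_excess μ δ ρ)
  have h0 := excess_nonneg μ δ ρ
  exact max_le (by linarith) (by linarith)

/-- Means outside the n largest may be arbitrarily negative, so a small probability of misplacing an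
item does not bound the resulting loss. The size of the shortfall is bounded by the deviation that
causes it, and this is integrated over the rank event. -/
lemma rankProb_mul_shortfall_le (hn : n ≤ m) (lay : Layout m n p q) (μ : Fin m → ℝ)
    (σ : Fin m → ℝ≥0) {δ : ℝ} (hint : Integrable (excess μ δ) (utilityLaw μ σ)) (i : Fin m)
    (j : Fin q) : rankProb lay μ σ i j * shortfall hn lay μ δ i j ≤
      2 * ∫ ρ, excess μ δ ρ ∂(utilityLaw μ σ) := by
  have h : rankProb lay μ σ i j * shortfall hn lay μ δ i j = ∫ ρ, (rankEvent lay i j).indicator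
      (fun _ => shortfall hn lay μ δ i j) ρ ∂(utilityLaw μ σ) := by
    rw [integral_indicator_const _ (measurableSet_rankEvent lay i j), rankProb_eq, smul_eq_mul]
  rw [h, ← integral_const_mul]
  refine integral_mono ((integrable_const _).indicator (measurableSet_rankEvent lay i j))
    (hint.const_mul 2) fun ρ => ?_
  by_cases hρ : ρ ∈ rankEvent lay i j
  · simpa [hρ] using shortfall_le hn δ hρ
  · simpa [hρ] using excess_nonneg μ δ ρ

lemma rankProb_le_of_shortfall_pos (hn : n ≤ m) {lay : Layout m n p q} {μ : Fin m → ℝ}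
    (σ : Fin m → ℝ≥0) {δ : ℝ} {i : Fin m} {j : Fin q} (h : 0 < shortfall hn lay μ δ i j) :
    rankProb lay μ σ i j ≤ (utilityLaw μ σ).real {ρ | 0 < excess μ δ ρ} := by
  rw [rankProb_eq]
  refine measureReal_mono fun ρ hρ => ?_
  have := shortfall_le (μ := μ) hn δ hρ
  change 0 < excess μ δ ρ
  linarith

/-- With zero excess, `lt_card_of_forall_notMem_rankEvent` forces `i` to be ranked by the end of
block `j`; the rest is a union bound. -/
lemma one_sub_sum_rankProb_le {lay : Layout m n p q} {μ : Fin m → ℝ} (σ : Fin m → ℝ≥0) {δ : ℝ}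
    {i : Fin m} {j : Fin q}
    (h : (Finset.univ.filter fun l => μ i - 2 * δ ≤ μ l).card ≤ (lay.last j : ℕ) + 1) :
    1 - ∑ j' ∈ Finset.Iic j, rankProb lay μ σ i j' ≤
      (utilityLaw μ σ).real {ρ | 0 < excess μ δ ρ} := by
  have hcover : (Set.univ : Set (Fin m → ℝ)) ⊆
      {ρ | 0 < excess μ δ ρ} ∪ ⋃ j' ∈ Finset.Iic j, rankEvent lay i j' := by
    intro ρ _
    by_contra hcon
    rw [Set.mem_union, not_or] at hcon
    have h0 : excess μ δ ρ = 0 := le_antisymm (not_lt.mp hcon.1) (excess_nonneg μ δ ρ)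
    have hz := abs_sub_le_add_excess μ δ ρ
    rw [h0, add_zero] at hz
    have := lt_card_of_forall_notMem_rankEvent (lay := lay) (i := i) (j := j) (fun j' hj' hmem =>
      hcon.2 (Set.mem_biUnion (Finset.mem_Iic.mpr hj') hmem)) hz
    omega
  have h1 := measureReal_mono (μ := utilityLaw μ σ) hcover
  have h2 := measureReal_union_le (μ := utilityLaw μ σ) {ρ | 0 < excess μ δ ρ}
    (⋃ j' ∈ Finset.Iic j, rankEvent lay i j')
  have h3 := measureReal_biUnion_finset_le (μ := utilityLaw μ σ) (Finset.Iic j) (rankEvent lay i)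
  rw [probReal_univ] at h1
  simp only [rankProb_eq]
  linarith

/-! ### The value of a run and of the optimum -/

/-- The largest value of a ranking for the item utilities `μ`. -/
def bestValue (hn : n ≤ m) (μ : Fin m → ℝ) (v : Fin n → ℝ) : ℝ :=
  ∑ t, desc μ (Fin.castLE hn t) * v t

/-- Expresses a sum over positions linearly in the block matrix of the ranking, so that its average
over a run depends only on the marginals. -/
lemma sum_apply_block_eq (lay : Layout m n p q) (R : Ranking m n)
    (d : Fin m → Fin q → ℝ) :
    ∑ t, d (R t) (lay.block t) = ∑ i, ∑ j, lay.proj (assignment R) i j * d i j := by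
  have h : ∀ i, ∑ j, lay.proj (assignment R) i j * d i j =
      ∑ t, assignment R i t * d i (lay.block t) := by
    intro i
    rw [← Finset.sum_fiberwise Finset.univ lay.block]
    refine Finset.sum_congr rfl fun j _ => ?_
    simp only [Layout.proj, Layout.positions]
    rw [Finset.sum_mul]
    refine Finset.sum_congr rfl fun t ht => ?_
    rw [(Finset.mem_filter.mp ht).2]
  simp only [h]
  rw [Finset.sum_comm]
  simp [assignment]

/-- The number of placements in a ranking that are untypical for the order of the means. -/
def misplaced (hn : n ≤ m) (lay : Layout m n p q) (μ : Fin m → ℝ) (δ : ℝ)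
    (M : Matrix (Fin m) (Fin q) ℝ) (i : Fin m) (j : Fin q) : ℝ :=
  (if 0 < shortfall hn lay μ δ i j then M i j else 0) +
    if (Finset.univ.filter fun l => μ i - 2 * δ ≤ μ l).card ≤ (lay.last j : ℕ) + 1
      then 1 - ∑ j' ∈ Finset.Iic j, M i j' else 0

lemma misplaced_nonneg (hn : n ≤ m) (lay : Layout m n p q) (μ : Fin m → ℝ) (δ : ℝ)
    (R : Ranking m n) (i : Fin m) (j : Fin q) :
    0 ≤ misplaced hn lay μ δ (lay.proj (assignment R)) i j := by
  have h := (sum_proj_le lay (assignment_nonneg R) i (Finset.Iic j)).trans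
    (sum_assignment_le_one R i)
  have h' := proj_assignment_nonneg lay R i j
  unfold misplaced
  split_ifs <;> linarith

lemma one_le_misplaced_of_shortfall (hn : n ≤ m) {lay : Layout m n p q} {μ : Fin m → ℝ} {δ : ℝ}
    {R : Ranking m n} {t : Fin n} (h : 0 < shortfall hn lay μ δ (R t) (lay.block t)) :
    1 ≤ misplaced hn lay μ δ (lay.proj (assignment R)) (R t) (lay.block t) := by
  have h1 := (sum_proj_le lay (assignment_nonneg R) (R t) (Finset.Iic (lay.block t))).trans
    (sum_assignment_le_one R (R t))
  unfold misplaced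
  rw [if_pos h, proj_assignment_eq_one ⟨t, rfl, rfl⟩]
  split_ifs <;> linarith

lemma one_le_misplaced_of_not_placed (hn : n ≤ m) {lay : Layout m n p q} {μ : Fin m → ℝ} {δ : ℝ}
    {R : Ranking m n} {i : Fin m} {j : Fin q}
    (h : (Finset.univ.filter fun l => μ i - 2 * δ ≤ μ l).card ≤ (lay.last j : ℕ) + 1)
    (hR : ¬ ∃ s, lay.block s ≤ j ∧ R s = i) :
    1 ≤ misplaced hn lay μ δ (lay.proj (assignment R)) i j := by
  have h0 : ∑ j' ∈ Finset.Iic j, lay.proj (assignment R) i j' = 0 := by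
    refine Finset.sum_eq_zero fun j' hj' => proj_assignment_eq_zero ?_
    rintro ⟨s, rfl, hs⟩
    exact hR ⟨s, Finset.mem_Iic.mp hj', hs⟩
  have h' := proj_assignment_nonneg lay R i j
  unfold misplaced
  rw [if_pos h, h0]
  split_ifs <;> linarith

lemma le_apply_of_sorted (hn : n ≤ m) {lay : Layout m n p q} {μ : Fin m → ℝ} {δ : ℝ}
    (hδ : 0 ≤ δ) (hμ : ∀ t : Fin n, 0 ≤ desc μ (Fin.castLE hn t)) {R : Ranking m n}
    (hsorted : ∀ s s', lay.block s = lay.block s' → s ≤ s' → μ (R s') ≤ μ (R s)) (t : Fin n) :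
    desc μ (Fin.castLE hn t) *
        (1 - ∑ i, ∑ j, misplaced hn lay μ δ (lay.proj (assignment R)) i j) - 4 * δ -
        shortfall hn lay μ δ (R t) (lay.block t) ≤ μ (R t) := by
  set β := ∑ i, ∑ j, misplaced hn lay μ δ (lay.proj (assignment R)) i j with hβ
  have hnn := misplaced_nonneg hn lay μ δ R
  have hs0 : 0 ≤ shortfall hn lay μ δ (R t) (lay.block t) := le_max_right _ _
  have hle : ∀ i j, misplaced hn lay μ δ (lay.proj (assignment R)) i j ≤ β := fun i j =>
    (Finset.single_le_sum (fun j _ => hnn i j) (Finset.mem_univ j)).trans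
      (Finset.single_le_sum (f := fun i => ∑ j, misplaced hn lay μ δ (lay.proj (assignment R)) i j)
        (fun i _ => Finset.sum_nonneg fun j _ => hnn i j) (Finset.mem_univ i))
  have hβ0 : 0 ≤ β := Finset.sum_nonneg fun i _ => Finset.sum_nonneg fun j _ => hnn i j
  rcases le_or_gt 1 β with h1 | h1
  -- With at least one violation the main term is nonpositive, and it suffices that the mean at the
  -- end of the block is nonnegative.
  · have h2 := mul_nonneg (hμ t) (sub_nonneg.mpr h1)
    have h3 : desc μ (Fin.castLE hn (lay.last (lay.block t))) - 2 * δ - μ (R t) ≤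
      shortfall hn lay μ δ (R t) (lay.block t) := le_max_left _ _
    nlinarith [hμ (lay.last (lay.block t))]
  -- Each violation contributes at least 1 to `β`, so `β < 1` excludes all of them.
  · have h2 := desc_sub_le_of_sorted hn hδ hsorted (fun s => by
      by_contra! hs
      have : 0 < shortfall hn lay μ δ (R s) (lay.block s) := lt_max_of_lt_left (by linarith)
      linarith [one_le_misplaced_of_shortfall hn this, hle (R s) (lay.block s)]) (fun i j hij => by
      by_contra hR
      linarith [one_le_misplaced_of_not_placed hn hij hR, hle i j]) t
    nlinarith [mul_nonneg (hμ t) hβ0]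

lemma expUtility_integral {D : Ranking m n → ℝ} (μ : Fin m → ℝ) (σ : Fin m → ℝ≥0)
    (v : Fin n → ℝ) :
    Integrable (fun ρ => expUtility ρ v D) (utilityLaw μ σ) ∧
    ∫ ρ, expUtility ρ v D ∂(utilityLaw μ σ) = ∑ R, D R * ∑ t, μ (R t) * v t := by
  have hmp : ∀ i, MeasurePreserving (Function.eval i) (utilityLaw μ σ)
      (gaussianReal (μ i) (σ i ^ 2)) := fun i => measurePreserving_eval _ i
  have hint : ∀ i, Integrable (fun ρ => ρ i) (utilityLaw μ σ) := fun i =>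
    (hmp i).integrable_comp_of_integrable
      ((memLp_id_gaussianReal 1).integrable le_rfl)
  have hval : ∀ i, ∫ ρ, ρ i ∂(utilityLaw μ σ) = μ i := fun i => by
    have := integral_map (μ := utilityLaw μ σ) (hmp i).measurable.aemeasurable
      (f := fun x : ℝ => x) (by fun_prop)
    rw [(hmp i).map_eq, integral_id_gaussianReal] at this
    exact this.symm
  simp only [expUtility, utility_assignment]
  have h1 : ∀ R : Ranking m n, Integrable (fun ρ => ∑ t, ρ (R t) * v t) (utilityLaw μ σ) := fun R =>
    integrable_finsetSum _ fun t _ => (hint _).mul_const _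
  refine ⟨integrable_finsetSum _ fun R _ => (h1 R).const_mul _, ?_⟩
  rw [integral_finsetSum _ fun R _ => (h1 R).const_mul _]
  refine Finset.sum_congr rfl fun R _ => ?_
  rw [integral_const_mul, integral_finsetSum _ fun t _ => (hint _).mul_const _]
  simp only [integral_mul_const, hval]

/-- The expected utility of the output of the algorithm is almost that of the best ranking for the
means. -/
lemma AlgRun.le_integral_expUtility (hn : n ≤ m) {lay : Layout m n p q}
    {L U : Matrix (Fin q) (Fin p) ℤ} {A : Matrix (Fin m) (Fin q) ℝ} {μ : Fin m → ℝ}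
    {σ : Fin m → ℝ≥0} {v : Fin n → ℝ} (hv : ∀ t, 0 ≤ v t)
    (hμ : ∀ t : Fin n, 0 ≤ desc μ (Fin.castLE hn t)) {δ : ℝ} (hδ : 0 ≤ δ)
    (hint : Integrable (excess μ δ) (utilityLaw μ σ))
    (run : AlgRun lay L U (rankProb lay μ σ) A μ v) :
    bestValue hn μ v * (1 - 2 * (m * q) * (utilityLaw μ σ).real {ρ | 0 < excess μ δ ρ}) -
        (∑ t, v t) * (4 * δ + 2 * (m * q) * ∫ ρ, excess μ δ ρ ∂(utilityLaw μ σ)) ≤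
      ∫ ρ, expUtility ρ v run.law ∂(utilityLaw μ σ) := by
  rw [(expUtility_integral μ σ v).2, run.sum_law_mul fun R => ∑ t, μ (R t) * v t]
  set P := (utilityLaw μ σ).real {ρ | 0 < excess μ δ ρ} with hP
  set E := ∫ ρ, excess μ δ ρ ∂(utilityLaw μ σ) with hE
  set V := ∑ t, v t with hV
  set B := bestValue hn μ v with hB
  have hB0 : 0 ≤ B := Finset.sum_nonneg fun t _ => mul_nonneg (hμ t) (hv t)
  have hP0 : 0 ≤ P := measureReal_nonneg
  have hV0 : 0 ≤ V := Finset.sum_nonneg fun t _ => hv t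
  have hmarg : ∀ i j, ∑ k, run.weight k * lay.proj (assignment (run.R k)) i j =
      rankProb lay μ σ i j := by
    intro i j
    rw [← congrFun₂ (run.feasible.proj_eq hn) i j, run.decompose, Matrix.sum_apply]
    simp [run.refine_proj]
  let β : Fin run.T → ℝ := fun k =>
    ∑ i, ∑ j, misplaced hn lay μ δ (lay.proj (assignment (run.R k))) i j
  let γ : Fin run.T → ℝ := fun k =>
    ∑ i, ∑ j, lay.proj (assignment (run.R k)) i j * shortfall hn lay μ δ i j
  have hpoint : ∀ k, B * (1 - β k) - V * (4 * δ) - V * γ k ≤ ∑ t, μ (run.R k t) * v t := by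
    intro k
    -- Bounding the discount of the shortfall term by `V` removes its dependence on the position, so
    -- that only blocks matter.
    have h1 : ∀ t, (desc μ (Fin.castLE hn t) * (1 - β k) - 4 * δ) * v t -
        V * shortfall hn lay μ δ (run.R k t) (lay.block t) ≤ μ (run.R k t) * v t := by
      intro t
      have h2 := mul_le_mul_of_nonneg_right
        (le_apply_of_sorted hn hδ hμ (run.refine_sorted k) t) (hv t)
      have h3 : shortfall hn lay μ δ (run.R k t) (lay.block t) * v t ≤
          shortfall hn lay μ δ (run.R k t) (lay.block t) * V :=
        mul_le_mul_of_nonneg_left (Finset.single_le_sum (fun t _ => hv t) (Finset.mem_univ t))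
          (le_max_right _ _)
      simp only [β]
      linarith
    refine le_trans (le_of_eq ?_) (Finset.sum_le_sum fun t _ => h1 t)
    rw [Finset.sum_sub_distrib, ← Finset.mul_sum, sum_apply_block_eq]
    simp only [sub_mul, Finset.sum_sub_distrib, ← Finset.mul_sum, B, bestValue, V, γ]
    congr 2
    · rw [Finset.sum_mul]
      exact Finset.sum_congr rfl fun t _ => by ring
    · ring
  have hβsum : ∑ k, run.weight k * β k ≤ 2 * (m * q) * P := by
    -- `misplaced` is affine in the matrix, so averaging over the run replaces each matching by the
    -- matrix of rank probabilities.
    have hmis : ∑ k, run.weight k * β k = ∑ i, ∑ j, misplaced hn lay μ δ (rankProb lay μ σ) i j := by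
      simp only [β, Finset.mul_sum]
      rw [Finset.sum_comm]
      refine Finset.sum_congr rfl fun i _ => ?_
      rw [Finset.sum_comm]
      refine Finset.sum_congr rfl fun j _ => ?_
      simp only [misplaced, mul_add, Finset.sum_add_distrib, mul_ite, mul_zero]
      congr 1
      · split_ifs
        · exact hmarg i j
        · simp
      · split_ifs
        · simp only [mul_sub, mul_one, Finset.sum_sub_distrib, run.weight_sum, Finset.mul_sum]
          rw [Finset.sum_comm]
          simp only [hmarg]
        · simp
    rw [hmis]
    have hle : ∀ i j, misplaced hn lay μ δ (rankProb lay μ σ) i j ≤ 2 * P := by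
      intro i j
      unfold misplaced
      have h1 : (if 0 < shortfall hn lay μ δ i j then rankProb lay μ σ i j else 0) ≤ P := by
        split_ifs with h
        · exact rankProb_le_of_shortfall_pos hn σ h
        · exact hP0
      have h2 : (if (Finset.univ.filter fun l => μ i - 2 * δ ≤ μ l).card ≤ (lay.last j : ℕ) + 1
          then 1 - ∑ j' ∈ Finset.Iic j, rankProb lay μ σ i j' else 0) ≤ P := by
        split_ifs with h
        · exact one_sub_sum_rankProb_le σ h
        · exact hP0
      linarith
    calc _ ≤ ∑ _i : Fin m, ∑ _j : Fin q, 2 * P :=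
          Finset.sum_le_sum fun i _ => Finset.sum_le_sum fun j _ => hle i j
      _ = 2 * (m * q) * P := by simp; ring
  have hγsum : ∑ k, run.weight k * γ k ≤ 2 * (m * q) * E := by
    have hmis : ∑ k, run.weight k * γ k =
        ∑ i, ∑ j, rankProb lay μ σ i j * shortfall hn lay μ δ i j := by
      simp only [γ, Finset.mul_sum]
      rw [Finset.sum_comm]
      refine Finset.sum_congr rfl fun i _ => ?_
      rw [Finset.sum_comm]
      refine Finset.sum_congr rfl fun j _ => ?_
      rw [← hmarg, Finset.sum_mul]
      exact Finset.sum_congr rfl fun k _ => by ring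
    rw [hmis]
    calc _ ≤ ∑ _i : Fin m, ∑ _j : Fin q, 2 * E := Finset.sum_le_sum fun i _ =>
          Finset.sum_le_sum fun j _ => rankProb_mul_shortfall_le hn lay μ σ hint i j
      _ = 2 * (m * q) * E := by simp; ring
  have hsum : B * (1 - ∑ k, run.weight k * β k) - V * (4 * δ) - V * ∑ k, run.weight k * γ k ≤
      ∑ k, run.weight k * ∑ t, μ (run.R k t) * v t := by
    refine le_trans (le_of_eq ?_) (Finset.sum_le_sum fun k _ =>
      mul_le_mul_of_nonneg_left (hpoint k) (run.weight_nonneg k))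
    have : ∀ k, run.weight k * (B * (1 - β k) - V * (4 * δ) - V * γ k) =
      run.weight k * (B - V * (4 * δ)) - B * (run.weight k * β k) - V * (run.weight k * γ k) :=
      fun k => by ring
    simp only [this, Finset.sum_sub_distrib, ← Finset.mul_sum, ← Finset.sum_mul, run.weight_sum]
    ring
  have e1 := mul_le_mul_of_nonneg_left hβsum hB0
  have e2 := mul_le_mul_of_nonneg_left hγsum hV0
  linarith

lemma expUtility_le (hn : n ≤ m) {v : Fin n → ℝ} (hv : ∀ t, 0 ≤ v t) (hanti : Antitone v)
    (μ ρ : Fin m → ℝ) (δ : ℝ) {D : Ranking m n → ℝ} (hD : D ∈ stdSimplex ℝ (Ranking m n)) :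
    expUtility ρ v D ≤ bestValue hn μ v + (∑ t, v t) * (δ + excess μ δ ρ) := by
  have h1 : ∀ R : Ranking m n, utility ρ v (assignment R) ≤
      bestValue hn μ v + (∑ t, v t) * (δ + excess μ δ ρ) := by
    intro R
    rw [utility_assignment]
    calc ∑ t, ρ (R t) * v t ≤ ∑ t, (μ (R t) * v t + v t * (δ + excess μ δ ρ)) := by
          refine Finset.sum_le_sum fun t _ => ?_
          have := (abs_le.mp (abs_sub_le_add_excess μ δ ρ (R t))).2
          nlinarith [mul_le_mul_of_nonneg_right this (hv t)]
      _ = ∑ t, μ (R t) * v t + (∑ t, v t) * (δ + excess μ δ ρ) := by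
          rw [Finset.sum_add_distrib, Finset.sum_mul]
      _ ≤ _ := by
          have := sum_ranking_le_sum_desc hn hv hanti μ R
          unfold bestValue
          linarith
  calc expUtility ρ v D ≤ ∑ R, D R * (bestValue hn μ v + (∑ t, v t) * (δ + excess μ δ ρ)) :=
        Finset.sum_le_sum fun R _ => mul_le_mul_of_nonneg_left (h1 R) (hD.1 R)
    _ = _ := by rw [← Finset.sum_mul, hD.2, one_mul]

/-! ### Gaussian tails -/

lemma integral_exp_gaussianReal (l d : ℝ) :
    Integrable (fun x => Real.exp (l * (x - d)) + Real.exp (l * (-x - d))) (gaussianReal 0 1) ∧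
    ∫ x, (Real.exp (l * (x - d)) + Real.exp (l * (-x - d))) ∂(gaussianReal 0 1) =
      2 * Real.exp (l ^ 2 / 2 - l * d) := by
  have hint : ∀ t : ℝ, Integrable (fun x => Real.exp (t * x)) (gaussianReal 0 1) := fun t =>
    integrable_exp_mul_gaussianReal t
  have hval : ∀ t : ℝ, ∫ x, Real.exp (t * x) ∂(gaussianReal 0 1) = Real.exp (t ^ 2 / 2) := by
    intro t
    have := congrFun (mgf_fun_id_gaussianReal (μ := 0) (v := 1)) t
    simpa [mgf] using this
  have hfun : (fun x => Real.exp (l * (x - d)) + Real.exp (l * (-x - d))) =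
      fun x => Real.exp (-(l * d)) * Real.exp (l * x) + Real.exp (-(l * d)) * Real.exp (-l * x) := by
    funext x
    rw [← Real.exp_add, ← Real.exp_add]
    congr 2 <;> ring
  rw [hfun]
  refine ⟨((hint l).const_mul _).add ((hint (-l)).const_mul _), ?_⟩
  rw [integral_add ((hint l).const_mul _) ((hint (-l)).const_mul _), integral_const_mul,
    integral_const_mul, hval, hval, sub_eq_add_neg, Real.exp_add, neg_sq]
  ring

lemma exp_abs_le (l d x : ℝ) :
    Real.exp (l * (|x| - d)) ≤ Real.exp (l * (x - d)) + Real.exp (l * (-x - d)) := by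
  rcases abs_choice x with h | h <;> rw [h] <;>
    linarith [Real.exp_pos (l * (x - d)), Real.exp_pos (l * (-x - d))]

lemma gaussianReal_eq_map (a : ℝ) (s : ℝ≥0) :
    gaussianReal a (s ^ 2) = (gaussianReal 0 1).map fun x => a + s * x := by
  have h : (fun x : ℝ => a + s * x) = (fun x => a + x) ∘ fun x => (s : ℝ) * x := rfl
  rw [h, ← Measure.map_map (by fun_prop) (by fun_prop), gaussianReal_map_const_mul,
    gaussianReal_map_const_add]
  congr 1
  · simp
  · ext; simp

/-- After rescaling to a standard Gaussian x, the single majorant `H`, which is at least exp(l(|x| -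
d)), gives both bounds: y ≤ exp y bounds the expected excess, and Markov's inequality at level 1
bounds the tail. -/
lemma integral_excess_le (μ : Fin m → ℝ) (σ : Fin m → ℝ≥0) {l d : ℝ} (hl : 0 < l) :
    Integrable (excess μ (sigmaMax σ * d)) (utilityLaw μ σ) ∧
    ∫ ρ, excess μ (sigmaMax σ * d) ρ ∂(utilityLaw μ σ) ≤
      m * (sigmaMax σ * l⁻¹ * (2 * Real.exp (l ^ 2 / 2 - l * d))) ∧
    (utilityLaw μ σ).real {ρ | 0 < excess μ (sigmaMax σ * d) ρ} ≤
      m * (2 * Real.exp (l ^ 2 / 2 - l * d)) := by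
  set s := sigmaMax σ with hs
  have hs0 : 0 ≤ s := NNReal.coe_nonneg _
  have hσ : ∀ i, (σ i : ℝ) ≤ s := fun i =>
    NNReal.coe_le_coe.mpr (Finset.le_sup (f := σ) (Finset.mem_univ i))
  obtain ⟨hHint, hH⟩ := integral_exp_gaussianReal l d
  set H : ℝ → ℝ := fun x => Real.exp (l * (x - d)) + Real.exp (l * (-x - d)) with hHdef
  have hmp : ∀ i, MeasurePreserving (fun ρ : Fin m → ℝ => ρ i) (utilityLaw μ σ)
      (gaussianReal (μ i) (σ i ^ 2)) := fun i => measurePreserving_eval _ i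
  have hmp' : ∀ i, MeasurePreserving (fun x : ℝ => μ i + σ i * x) (gaussianReal 0 1)
      (gaussianReal (μ i) (σ i ^ 2)) := fun i => ⟨by fun_prop, (gaussianReal_eq_map _ _).symm⟩
  have habs : ∀ i (x : ℝ), |μ i + σ i * x - μ i| ≤ s * |x| := fun i x => by
    rw [add_sub_cancel_left, abs_mul, NNReal.abs_eq]
    exact mul_le_mul_of_nonneg_right (hσ i) (abs_nonneg x)
  let φ : Fin m → ℝ → ℝ := fun i y => max (|y - μ i| - s * d) 0
  have hφm : ∀ i, Continuous (φ i) := fun i => by fun_prop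
  have hφ : ∀ i x, φ i (μ i + σ i * x) ≤ s * l⁻¹ * H x := by
    intro i x
    have h1 := (Real.add_one_le_exp (l * (|x| - d))).trans (exp_abs_le l d x)
    have h2 : |x| - d ≤ l⁻¹ * H x := by
      rw [inv_mul_eq_div, le_div_iff₀ hl]
      linarith
    have h0 : 0 ≤ H x := by positivity
    refine max_le ?_ (by positivity)
    have := mul_le_mul_of_nonneg_left h2 hs0
    linarith [habs i x]
  have hφint' : ∀ i, Integrable (fun x => φ i (μ i + σ i * x)) (gaussianReal 0 1) := fun i =>
    (hHint.const_mul (s * l⁻¹)).mono' (Continuous.aestronglyMeasurable (by fun_prop))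
      (Filter.Eventually.of_forall fun x => by
        rw [Real.norm_of_nonneg (le_max_right _ _)]
        exact hφ i x)
  have hφint : ∀ i, Integrable (φ i) (gaussianReal (μ i) (σ i ^ 2)) := fun i =>
    ((hmp' i).integrable_comp (hφm i).aestronglyMeasurable).mp (hφint' i)
  have hint : ∀ i, Integrable (fun ρ => φ i (ρ i)) (utilityLaw μ σ) := fun i =>
    (hmp i).integrable_comp_of_integrable (hφint i)
  refine ⟨integrable_finsetSum _ fun i _ => hint i, ?_, ?_⟩
  · change ∫ ρ, ∑ i, φ i (ρ i) ∂(utilityLaw μ σ) ≤ _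
    rw [integral_finsetSum _ fun i _ => hint i]
    have : ∀ i, ∫ ρ, φ i (ρ i) ∂(utilityLaw μ σ) ≤
        s * l⁻¹ * (2 * Real.exp (l ^ 2 / 2 - l * d)) := by
      intro i
      have e1 := integral_map (μ := utilityLaw μ σ) (hmp i).measurable.aemeasurable
        (f := φ i) (hφm i).aestronglyMeasurable
      have e2 := integral_map (μ := gaussianReal 0 1) (hmp' i).measurable.aemeasurable
        (f := φ i) (hφm i).aestronglyMeasurable
      rw [(hmp i).map_eq] at e1
      rw [(hmp' i).map_eq] at e2
      rw [← e1, e2, ← hH, ← integral_const_mul]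
      exact integral_mono (hφint' i) (hHint.const_mul _) (hφ i)
    calc _ ≤ ∑ _i : Fin m, s * l⁻¹ * (2 * Real.exp (l ^ 2 / 2 - l * d)) :=
          Finset.sum_le_sum fun i _ => this i
      _ = _ := by simp
  · have hsub : {ρ | 0 < excess μ (s * d) ρ} ⊆ ⋃ i, (fun ρ : Fin m → ℝ => ρ i) ⁻¹' {y | 0 < φ i y} := by
      intro ρ hρ
      by_contra hcon
      rw [Set.mem_iUnion, not_exists] at hcon
      have : excess μ (s * d) ρ ≤ 0 := Finset.sum_nonpos fun i _ => not_lt.mp (hcon i)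
      exact absurd hρ (not_lt.mpr this)
    have hone : ∀ i, (utilityLaw μ σ).real ((fun ρ : Fin m → ℝ => ρ i) ⁻¹' {y | 0 < φ i y}) ≤
        2 * Real.exp (l ^ 2 / 2 - l * d) := by
      intro i
      have hms : MeasurableSet {y | 0 < φ i y} := measurableSet_lt measurable_const (hφm i).measurable
      rw [(hmp i).measureReal_preimage hms.nullMeasurableSet,
        ← (hmp' i).measureReal_preimage hms.nullMeasurableSet, ← hH]
      have hmarkov := mul_meas_ge_le_integral_of_nonneg (μ := gaussianReal 0 1) (f := H)
        (Filter.Eventually.of_forall fun x => by positivity) hHint 1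
      rw [one_mul] at hmarkov
      refine le_trans (measureReal_mono fun x hx => ?_) hmarkov
      have hx' : 0 < max (|μ i + σ i * x - μ i| - s * d) 0 := hx
      have h1 : 0 < |μ i + σ i * x - μ i| - s * d := by simpa using hx'
      have h2 : 0 < s * (|x| - d) := by linarith [habs i x]
      have h3 : 0 < |x| - d := pos_of_mul_pos_right h2 hs0
      have h4 : 1 ≤ Real.exp (l * (|x| - d)) := Real.one_le_exp (by positivity)
      exact h4.trans (exp_abs_le l d x)
    calc _ ≤ _ := measureReal_mono hsub
      _ ≤ _ := measureReal_iUnion_fintype_le _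
      _ ≤ ∑ _i : Fin m, 2 * Real.exp (l ^ 2 / 2 - l * d) := Finset.sum_le_sum fun i _ => hone i
      _ = _ := by simp

/-! ### The guarantee for deterministic means -/

lemma inv_le_rpow_neg_quarter (hm : 1 ≤ m) : (m : ℝ)⁻¹ ≤ (m : ℝ) ^ (-(1 / 4) : ℝ) := by
  rw [← Real.rpow_neg_one]
  exact Real.rpow_le_rpow_of_exponent_le (by exact_mod_cast hm) (by norm_num)

/-- Deviations beyond a multiple of `σ_max √(log m)` are negligible. -/
lemma excess_bounds (hm : 2 ≤ m) (μ : Fin m → ℝ) (σ : Fin m → ℝ≥0) :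
    ∃ δ : ℝ, 0 ≤ δ ∧ δ ≤ 9 / 2 * (sigmaMax σ * √(Real.log m)) ∧
      Integrable (excess μ δ) (utilityLaw μ σ) ∧
      2 * (m * m) * ∫ ρ, excess μ δ ρ ∂(utilityLaw μ σ) ≤ 4 * (sigmaMax σ * √(Real.log m)) ∧
      2 * (m * m) * (utilityLaw μ σ).real {ρ | 0 < excess μ δ ρ} ≤
        4 * (m : ℝ) ^ (-(1 / 4) : ℝ) := by
  set l := √(Real.log m) with hl
  have hm' : (2 : ℝ) ≤ m := by exact_mod_cast hm
  have hm0 : (0 : ℝ) < m := by linarith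
  have hlog : 1 / 2 < Real.log m := by
    have := Real.log_le_log (by norm_num) hm'
    linarith [Real.log_two_gt_d9]
  have hl0 : 0 < l := Real.sqrt_pos.mpr (by linarith)
  have hl2 : l ^ 2 = Real.log m := Real.sq_sqrt (by linarith)
  have hs0 : 0 ≤ sigmaMax σ := NNReal.coe_nonneg _
  -- The factor 9/2 is chosen so that the exponent is -4 log m; the resulting m⁻⁴ absorbs m² pairs
  -- of item and block and the m items in the union bound, leaving 1/m.
  have hexp : Real.exp (l ^ 2 / 2 - l * (9 / 2 * l)) = ((m : ℝ) ^ 4)⁻¹ := by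
    rw [show l ^ 2 / 2 - l * (9 / 2 * l) = -(4 * l ^ 2) by ring, hl2, Real.exp_neg,
      show (4 : ℝ) * Real.log m = Real.log ((m : ℝ) ^ 4) by simp [Real.log_pow],
      Real.exp_log (by positivity)]
  obtain ⟨h1, h2, h3⟩ := integral_excess_le μ σ (d := 9 / 2 * l) hl0
  rw [hexp] at h2 h3
  refine ⟨sigmaMax σ * (9 / 2 * l), by positivity, by linarith, h1, ?_, ?_⟩
  · have hinv : l⁻¹ * (m : ℝ)⁻¹ ≤ l := by
      rw [← mul_inv, inv_le_iff_one_le_mul₀ (by positivity)]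
      nlinarith
    calc _ ≤ 2 * ((m : ℝ) * m) * (m * (sigmaMax σ * l⁻¹ * (2 * ((m : ℝ) ^ 4)⁻¹))) := by gcongr
      _ = 4 * (sigmaMax σ * (l⁻¹ * (m : ℝ)⁻¹)) := by field_simp; ring
      _ ≤ _ := by gcongr
  · calc _ ≤ 2 * ((m : ℝ) * m) * (m * (2 * ((m : ℝ) ^ 4)⁻¹)) := by gcongr
      _ = 4 * (m : ℝ)⁻¹ := by field_simp; ring
      _ ≤ _ := by gcongr; exact inv_le_rpow_neg_quarter (by omega)

lemma bestValue_nonneg (hn : n ≤ m) {μ : Fin m → ℝ} {v : Fin n → ℝ} (hv : ∀ t, 0 ≤ v t)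
    (hμ : ∀ t : Fin n, 0 ≤ desc μ (Fin.castLE hn t)) : 0 ≤ bestValue hn μ v :=
  Finset.sum_nonneg fun t _ => mul_nonneg (hμ t) (hv t)

lemma AlgRun.bestValue_sub_le (hn : n ≤ m) (hm : 2 ≤ m) {lay : Layout m n p q}
    {L U : Matrix (Fin q) (Fin p) ℤ} {A : Matrix (Fin m) (Fin q) ℝ} {μ : Fin m → ℝ}
    {σ : Fin m → ℝ≥0} {v : Fin n → ℝ} (hv : ∀ t, 0 ≤ v t)
    (hμ : ∀ t : Fin n, 0 ≤ desc μ (Fin.castLE hn t))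
    (run : AlgRun lay L U (rankProb lay μ σ) A μ v) :
    bestValue hn μ v * (1 - 4 * (m : ℝ) ^ (-(1 / 4) : ℝ)) -
        22 * (∑ t, v t) * (sigmaMax σ * √(Real.log m)) ≤
      ∫ ρ, expUtility ρ v run.law ∂(utilityLaw μ σ) := by
  obtain ⟨δ, hδ0, hδ, hint, hE, hP⟩ := excess_bounds hm μ σ
  refine le_trans ?_ (run.le_integral_expUtility hn hv hμ hδ0 hint)
  have hq : (q : ℝ) ≤ m := by exact_mod_cast lay.card_blocks_le.trans hn
  have hE0 : 0 ≤ ∫ ρ, excess μ δ ρ ∂(utilityLaw μ σ) := integral_nonneg (excess_nonneg μ δ)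
  have hP0 : 0 ≤ (utilityLaw μ σ).real {ρ | 0 < excess μ δ ρ} := measureReal_nonneg
  have hE' : 2 * ((m : ℝ) * q) * ∫ ρ, excess μ δ ρ ∂(utilityLaw μ σ) ≤
      4 * (sigmaMax σ * √(Real.log m)) := le_trans (by gcongr) hE
  have hP' : 2 * ((m : ℝ) * q) * (utilityLaw μ σ).real {ρ | 0 < excess μ δ ρ} ≤
      4 * (m : ℝ) ^ (-(1 / 4) : ℝ) := le_trans (by gcongr) hP
  have e1 := mul_le_mul_of_nonneg_left hP' (bestValue_nonneg hn hv hμ)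
  -- Four copies of δ ≤ 9/2 · σ_max √(log m), plus 4 from the excess, make the 22.
  have e2 := mul_le_mul_of_nonneg_left (add_le_add hδ (add_le_add hδ (add_le_add hδ
    (add_le_add hδ hE')))) (Finset.sum_nonneg fun t (_ : t ∈ Finset.univ) => hv t)
  linarith

/-- The value of the optimum need not be integrable in the utilities; its integral is then 0 by
convention, which is why `0 ≤ b` is required. -/
lemma integral_le_of_le {Ω : Type*} [MeasurableSpace Ω] {P : Measure Ω} {f g : Ω → ℝ} {b : ℝ}
    (hg : Integrable g P) (hfg : ∀ᵐ ω ∂P, f ω ≤ g ω) (hb : 0 ≤ b) (hgb : ∫ ω, g ω ∂P ≤ b) :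
    ∫ ω, f ω ∂P ≤ b := by
  by_cases hf : Integrable f P
  · exact (integral_mono_ae hf hg hfg).trans hgb
  · rwa [integral_undef hf]

lemma integral_expUtility_le (hn : n ≤ m) (hm : 2 ≤ m) (μ : Fin m → ℝ) (σ : Fin m → ℝ≥0)
    {v : Fin n → ℝ} (hv : ∀ t, 0 ≤ v t) (hanti : Antitone v)
    (hμ : ∀ t : Fin n, 0 ≤ desc μ (Fin.castLE hn t)) {D : (Fin m → ℝ) → Ranking m n → ℝ}
    (hD : ∀ ρ, D ρ ∈ stdSimplex ℝ (Ranking m n)) :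
    ∫ ρ, expUtility ρ v (D ρ) ∂(utilityLaw μ σ) ≤
      bestValue hn μ v + 9 * (∑ t, v t) * (sigmaMax σ * √(Real.log m)) := by
  obtain ⟨δ, hδ0, hδ, hint, hE, -⟩ := excess_bounds hm μ σ
  have hV : 0 ≤ ∑ t, v t := Finset.sum_nonneg fun t _ => hv t
  have hs0 : 0 ≤ sigmaMax σ := NNReal.coe_nonneg _
  have hE0 : 0 ≤ ∫ ρ, excess μ δ ρ ∂(utilityLaw μ σ) := integral_nonneg (excess_nonneg μ δ)
  have hm' : (2 : ℝ) ≤ m := by exact_mod_cast hm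
  have hg : Integrable (fun ρ => (∑ t, v t) * (δ + excess μ δ ρ)) (utilityLaw μ σ) :=
    ((integrable_const _).add hint).const_mul _
  refine integral_le_of_le
    (g := fun ρ => bestValue hn μ v + (∑ t, v t) * (δ + excess μ δ ρ)) ?_
    (Filter.Eventually.of_forall fun ρ => expUtility_le hn hv hanti μ ρ δ (hD ρ))
    (add_nonneg (bestValue_nonneg hn hv hμ) (by positivity)) ?_
  · exact (integrable_const _).add hg
  · rw [integral_add (integrable_const _) hg, integral_const_mul,
      integral_add (integrable_const _) hint]
    simp only [integral_const, probReal_univ, one_smul]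
    have h1 : ∫ ρ, excess μ δ ρ ∂(utilityLaw μ σ) ≤ 4 * (sigmaMax σ * √(Real.log m)) := by
      refine le_trans (le_mul_of_one_le_left hE0 ?_) hE
      nlinarith
    have h2 : δ + ∫ ρ, excess μ δ ρ ∂(utilityLaw μ σ) ≤ 9 * (sigmaMax σ * √(Real.log m)) := by
      have : 0 ≤ sigmaMax σ * √(Real.log m) := by positivity
      linarith
    linarith [mul_le_mul_of_nonneg_left h2 hV]

lemma mul_sum_le_bestValue (hn : n ≤ m) {μ : Fin m → ℝ} {v : Fin n → ℝ} (hv : ∀ t, 0 ≤ v t)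
    {θ : ℝ} (hθ : ∀ t : Fin n, θ ≤ desc μ (Fin.castLE hn t)) :
    θ * ∑ t, v t ≤ bestValue hn μ v := by
  rw [Finset.mul_sum]
  exact Finset.sum_le_sum fun t _ => mul_le_mul_of_nonneg_right (hθ t) (hv t)

lemma alphaBound_eq (K : ℝ) (σ : Fin m → ℝ≥0) (s : ℝ) :
    alphaBound K σ s = 1 - K * (sigmaMax σ * √(Real.log m)) / s - K * (m : ℝ) ^ (-(1 / 4) : ℝ) := by
  unfold alphaBound
  ring

/-- For m = 1 the logarithm vanishes and the last term is K, so the bound is 1 - K ≤ 0. -/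
lemma two_le_of_alphaBound_pos {K : ℝ} (hK : 1 ≤ K) (hm : 0 < m) {σ : Fin m → ℝ≥0} {s : ℝ}
    (h : 0 < alphaBound K σ s) : 2 ≤ m := by
  by_contra! hm2
  obtain rfl : m = 1 := by omega
  simp [alphaBound] at h
  linarith

/-- Here `x` stands for σ_max √(log m), `y` for m^(-1/4), `X` for the optimum and `Y` for the
algorithm. The additive losses 9 and 22 total 31 Vx, which `B ≥ c s V` turns into a fraction of `B`
as soon as Kc ≥ 31. -/
lemma alpha_mul_le_of_bounds {a B V x y s c X Y K : ℝ} (hs : 0 < s) (hx : 0 ≤ x) (hy : 0 ≤ y)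
    (hV : 0 ≤ V) (hc : 0 < c) (hK : 31 ≤ K) (hKc : 31 ≤ K * c) (ha : 0 ≤ a)
    (haK : a ≤ 1 - K * x / s - K * y) (hB : c * s * V ≤ B) (hX : X ≤ B + 9 * V * x)
    (hY : B * (1 - 4 * y) - 22 * V * x ≤ Y) : a * X ≤ Y := by
  have hB0 : 0 ≤ B := le_trans (by positivity) hB
  have hx' : 0 ≤ K * x / s := by positivity
  have ha1 : a ≤ 1 := haK.trans (by nlinarith)
  have h1 : a * X ≤ a * B + 9 * V * x := by
    nlinarith [mul_le_mul_of_nonneg_left hX ha, mul_nonneg hV hx,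
      mul_le_mul_of_nonneg_right ha1 (mul_nonneg hV hx)]
  have h2 := mul_le_mul_of_nonneg_right haK hB0
  have h3 : 31 * V * x ≤ K * x / s * B := by
    calc 31 * V * x = 31 * (V * x) := by ring
      _ ≤ K * c * (V * x) := mul_le_mul_of_nonneg_right hKc (mul_nonneg hV hx)
      _ = K * x / s * (c * s * V) := by field_simp
      _ ≤ _ := mul_le_mul_of_nonneg_left hB hx'
  nlinarith [mul_nonneg (mul_nonneg hy hB0) (by linarith : 0 ≤ K - 4)]

/-- The guarantee when the `n` largest means are all at least `c s`. -/
lemma AlgRun.alphaBound_mul_le (hn : n ≤ m) (hm : 0 < m) {lay : Layout m n p q}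
    {L U : Matrix (Fin q) (Fin p) ℤ} {A : Matrix (Fin m) (Fin q) ℝ} {μ : Fin m → ℝ}
    {σ : Fin m → ℝ≥0} {v : Fin n → ℝ} (hv : ∀ t, 0 ≤ v t) (hanti : Antitone v) {s c K : ℝ}
    (hs : 0 < s) (hc : 0 < c) (hK : 31 ≤ K) (hKc : 31 ≤ K * c)
    (hμ : ∀ t : Fin n, c * s ≤ desc μ (Fin.castLE hn t))
    (hpos : 0 < alphaBound K σ s)
    (run : AlgRun lay L U (rankProb lay μ σ) A μ v) {D : (Fin m → ℝ) → Ranking m n → ℝ}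
    (hD : ∀ ρ, IsOptimalFair lay L U (rankProb lay μ σ) A ρ v (D ρ)) :
    alphaBound K σ s * ∫ ρ, expUtility ρ v (D ρ) ∂(utilityLaw μ σ) ≤
      ∫ ρ, expUtility ρ v run.law ∂(utilityLaw μ σ) := by
  have hm2 := two_le_of_alphaBound_pos (by linarith) hm hpos
  have hμ0 : ∀ t : Fin n, 0 ≤ desc μ (Fin.castLE hn t) := fun t =>
    (mul_pos hc hs).le.trans (hμ t)
  have hs0 : 0 ≤ sigmaMax σ := NNReal.coe_nonneg _
  exact alpha_mul_le_of_bounds hs (by positivity) (by positivity)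
    (Finset.sum_nonneg fun t _ => hv t) hc hK hKc hpos.le (alphaBound_eq K σ s).le
    (mul_sum_le_bestValue hn hv hμ)
    (integral_expUtility_le hn hm2 μ σ hv hanti hμ0 fun ρ => (hD ρ).1.distribution)
    (run.bestValue_sub_le hn hm2 hv hμ0)

lemma AlgRun.integral_expUtility_nonneg {lay : Layout m n p q}
    {L U : Matrix (Fin q) (Fin p) ℤ} {C A : Matrix (Fin m) (Fin q) ℝ} {μ : Fin m → ℝ}
    {σ : Fin m → ℝ≥0} {v : Fin n → ℝ} (hv : ∀ t, 0 ≤ v t) (hμ : ∀ i, 0 ≤ μ i)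
    (run : AlgRun lay L U C A μ v) :
    0 ≤ ∫ ρ, expUtility ρ v run.law ∂(utilityLaw μ σ) := by
  rw [(expUtility_integral μ σ v).2]
  exact Finset.sum_nonneg fun R _ => mul_nonneg (run.isFair_law.distribution.1 R)
    (Finset.sum_nonneg fun t _ => mul_nonneg (hμ _) (hv t))

/-- The law of the run is fair, so the optimum dominates it for each `ρ`. This settles the case of a
nonpositive factor α. -/
lemma AlgRun.integral_optimal_nonneg {lay : Layout m n p q}
    {L U : Matrix (Fin q) (Fin p) ℤ} {C A : Matrix (Fin m) (Fin q) ℝ} {μ : Fin m → ℝ}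
    {σ : Fin m → ℝ≥0} {v : Fin n → ℝ} (hv : ∀ t, 0 ≤ v t) (hμ : ∀ i, 0 ≤ μ i)
    (run : AlgRun lay L U C A μ v) {D : (Fin m → ℝ) → Ranking m n → ℝ}
    (hD : ∀ ρ, IsOptimalFair lay L U C A ρ v (D ρ)) :
    0 ≤ ∫ ρ, expUtility ρ v (D ρ) ∂(utilityLaw μ σ) := by
  by_cases hint : Integrable (fun ρ => expUtility ρ v (D ρ)) (utilityLaw μ σ)
  · exact (run.integral_expUtility_nonneg hv hμ).trans (integral_mono (expUtility_integral μ σ v).1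
      hint fun ρ => (hD ρ).2 _ run.isFair_law)
  · rw [integral_undef hint]

lemma le_desc_of_isKthLargest (hn : n ≤ m) {μ : Fin m → ℝ} {y : ℝ} (h : IsKthLargest μ n y)
    (t : Fin n) : y ≤ desc μ (Fin.castLE hn t) :=
  le_desc_of_lt_card (lt_of_lt_of_le t.isLt h.2)

/-! ### Means that are uniform on an interval -/

lemma isProbabilityMeasure_cond_Icc {S : ℝ} (hS : 0 < S) :
    IsProbabilityMeasure (cond volume (Set.Icc 0 S)) :=
  cond_isProbabilityMeasure_of_finite (by simp [hS]) (by simp)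

lemma isProbabilityMeasure_meansLaw (m : ℕ) {S : ℝ} (hS : 0 < S) :
    IsProbabilityMeasure (meansLaw m S) := by
  have := isProbabilityMeasure_cond_Icc hS
  unfold meansLaw
  infer_instance

lemma ae_mem_Icc_meansLaw (m : ℕ) {S : ℝ} (hS : 0 < S) :
    ∀ᵐ μ ∂(meansLaw m S), ∀ i, μ i ∈ Set.Icc 0 S := by
  have := isProbabilityMeasure_cond_Icc hS
  rw [ae_all_iff]
  intro i
  have h : ∀ᵐ x ∂(cond volume (Set.Icc 0 S)), x ∈ Set.Icc (0 : ℝ) S :=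
    ae_cond_mem measurableSet_Icc
  exact (measurePreserving_eval (fun _ : Fin m => cond volume (Set.Icc 0 S)) i).quasiMeasurePreserving.ae h

lemma cond_Icc_Iio_le {S θ : ℝ} (hS : 0 < S) (hθ : 0 ≤ θ) :
    (cond volume (Set.Icc 0 S)).real (Set.Iio θ) ≤ θ / S := by
  rw [measureReal_def, cond_apply measurableSet_Icc, ENNReal.toReal_mul, ENNReal.toReal_inv,
    ← measureReal_def, ← measureReal_def, inv_mul_eq_div, Real.volume_real_Icc_of_le hS.le, sub_zero]
  refine div_le_div_of_nonneg_right ?_ hS.le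
  have : (volume : Measure ℝ).real (Set.Icc 0 S ∩ Set.Iio θ) ≤ volume.real (Set.Icc 0 θ) :=
    measureReal_mono (fun x hx => ⟨hx.1.1, le_of_lt hx.2⟩) (by simp)
  rwa [Real.volume_real_Icc_of_le hθ, sub_zero] at this

/-- The means for which the `n` largest of them are at least `θ`. -/
def largeMeans (m n : ℕ) (θ : ℝ) : Set (Fin m → ℝ) :=
  {μ | n ≤ (Finset.univ.filter fun i => θ ≤ μ i).card}

lemma measurableSet_largeMeans (m n : ℕ) (θ : ℝ) : MeasurableSet (largeMeans m n θ) := by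
  have h : Measurable fun μ : Fin m → ℝ => (Finset.univ.filter fun i => θ ≤ μ i).card := by
    simp only [Finset.card_filter]
    refine Finset.measurable_sum _ fun i _ => Measurable.ite ?_ measurable_const measurable_const
    exact measurableSet_le measurable_const (measurable_pi_apply i)
  exact measurableSet_le measurable_const h

lemma le_desc_of_mem_largeMeans (hn : n ≤ m) {μ : Fin m → ℝ} {θ : ℝ} (h : μ ∈ largeMeans m n θ)
    (t : Fin n) : θ ≤ desc μ (Fin.castLE hn t) :=
  le_desc_of_lt_card (lt_of_lt_of_le t.isLt h)

/-- Chebyshev's inequality for the number of means below θ: its expectation is at most cm/2 and its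
variance at most m/4, while failure makes it exceed cm. -/
lemma one_sub_le_largeMeans (hm : 0 < m) {c : ℝ} (hc : 0 < c) (hn : (n : ℝ) ≤ (1 - c) * m)
    {S : ℝ} (hS : 0 < S) :
    1 - 1 / c ^ 2 * (m : ℝ) ^ (-(1 / 4) : ℝ) ≤ (meansLaw m S).real (largeMeans m n (c / 2 * S)) := by
  set θ := c / 2 * S with hθ
  have hθ0 : 0 ≤ θ := by positivity
  have hm0 : (0 : ℝ) < m := by exact_mod_cast hm
  have hprob := isProbabilityMeasure_cond_Icc hS
  have := isProbabilityMeasure_meansLaw m hS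
  set ν := cond volume (Set.Icc 0 S) with hν
  let f : ℝ → ℝ := (Set.Iio θ).indicator fun _ => 1
  have hf01 : ∀ x, f x ∈ Set.Icc (0 : ℝ) 1 := by
    intro x
    by_cases hx : x ∈ Set.Iio θ <;> simp [f, hx]
  have hfm : Measurable f := measurable_const.indicator measurableSet_Iio
  have hfL : MemLp f 2 ν := MemLp.of_bound hfm.aestronglyMeasurable 1
    (Filter.Eventually.of_forall fun x => by
      rw [Real.norm_of_nonneg (hf01 x).1]; exact (hf01 x).2)
  have hfint : ∫ x, f x ∂ν ≤ c / 2 := by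
    rw [integral_indicator_const _ measurableSet_Iio, smul_eq_mul, mul_one]
    refine (cond_Icc_Iio_le hS hθ0).trans (le_of_eq ?_)
    rw [hθ, mul_div_assoc, div_self hS.ne', mul_one]
  have hmp : ∀ i, MeasurePreserving (fun μ : Fin m → ℝ => μ i) (meansLaw m S) ν := fun i =>
    measurePreserving_eval (fun _ : Fin m => ν) i
  let N : (Fin m → ℝ) → ℝ := ∑ i, fun μ : Fin m → ℝ => f (μ i)
  have hNapply : ∀ μ, N μ = ∑ i, f (μ i) := fun μ => Finset.sum_apply _ _ _
  have hfi : ∀ i, MemLp (fun μ : Fin m → ℝ => f (μ i)) 2 (meansLaw m S) := fun i =>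
    hfL.comp_measurePreserving (hmp i)
  have hNL : MemLp N 2 (meansLaw m S) := memLp_finsetSum' _ fun i _ => hfi i
  have hmean : ∫ μ, N μ ∂(meansLaw m S) ≤ m * (c / 2) := by
    simp only [hNapply]
    rw [integral_finsetSum _ fun i _ => (hfi i).integrable one_le_two]
    have : ∀ i, ∫ μ, f (μ i) ∂(meansLaw m S) ≤ c / 2 := fun i => by
      have e := integral_map (μ := meansLaw m S) (hmp i).measurable.aemeasurable
        (f := f) hfm.aestronglyMeasurable
      rw [(hmp i).map_eq] at e
      rwa [← e]
    calc _ ≤ ∑ _i : Fin m, c / 2 := Finset.sum_le_sum fun i _ => this i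
      _ = _ := by simp
  have hvar : variance N (meansLaw m S) ≤ m * (1 / 4) := by
    have h1 : variance N (meansLaw m S) = ∑ _i : Fin m, variance f ν :=
      variance_sum_pi (μ := fun _ : Fin m => ν) (X := fun _ => f) fun _ => hfL
    have h2 : variance f ν ≤ ((1 - 0) / 2) ^ 2 :=
      variance_le_sq_of_bounded (Filter.Eventually.of_forall hf01) hfm.aemeasurable
    rw [h1]
    calc _ ≤ ∑ _i : Fin m, ((1 - 0) / 2 : ℝ) ^ 2 := Finset.sum_le_sum fun i _ => h2
      _ = _ := by simp; norm_num
  have hcm : 0 < m * (c / 2) := by positivity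
  have hsub : (largeMeans m n θ)ᶜ ⊆ {μ | m * (c / 2) ≤ |N μ - ∫ μ, N μ ∂(meansLaw m S)|} := by
    intro μ hμ
    have hμ' : (Finset.univ.filter fun i => θ ≤ μ i).card < n := not_le.mp hμ
    have hN : N μ = m - ((Finset.univ.filter fun i => θ ≤ μ i).card : ℝ) := by
      have hf : ∀ x, f x = 1 - if θ ≤ x then 1 else 0 := by
        intro x
        by_cases hx : θ ≤ x
        · simp [f, hx]
        · simp [f, hx, not_le.mp hx]
      rw [hNapply]
      simp [hf]
    have h1 : ((Finset.univ.filter fun i => θ ≤ μ i).card : ℝ) < n := by exact_mod_cast hμ'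
    have h2 := le_abs_self (N μ - ∫ μ, N μ ∂(meansLaw m S))
    change m * (c / 2) ≤ |N μ - ∫ μ, N μ ∂(meansLaw m S)|
    linarith
  have hcheb := meas_ge_le_variance_div_sq hNL hcm
  have hcompl : (meansLaw m S).real (largeMeans m n θ)ᶜ ≤ 1 / c ^ 2 * (m : ℝ)⁻¹ := by
    have h1 : (meansLaw m S) (largeMeans m n θ)ᶜ ≤ ENNReal.ofReal (1 / c ^ 2 * (m : ℝ)⁻¹) := by
      refine (measure_mono hsub).trans (hcheb.trans (ENNReal.ofReal_le_ofReal ?_))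
      rw [div_le_iff₀ (by positivity)]
      refine hvar.trans (le_of_eq ?_)
      field_simp
      ring
    exact ENNReal.toReal_le_of_le_ofReal (by positivity) h1
  rw [probReal_compl_eq_one_sub (measurableSet_largeMeans m n θ)] at hcompl
  have := mul_le_mul_of_nonneg_left (inv_le_rpow_neg_quarter hm) (by positivity : 0 ≤ 1 / c ^ 2)
  linarith

/-- A maximum of finitely many linear functions is visibly measurable, whereas the sorting
permutation makes `desc` awkward to treat directly. -/
lemma bestValue_eq_sup (hn : n ≤ m) {v : Fin n → ℝ} (hv : ∀ t, 0 ≤ v t) (hanti : Antitone v) :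
    (fun μ => bestValue hn μ v) = (Finset.univ : Finset (Ranking m n)).sup'
      (Finset.nonempty_def.mpr ⟨Fin.castLEEmb hn, Finset.mem_univ _⟩) fun R μ => ∑ t, μ (R t) * v t := by
  funext μ
  rw [Finset.sup'_apply]
  refine le_antisymm ?_ (Finset.sup'_le _ _ fun R _ => sum_ranking_le_sum_desc hn hv hanti μ R)
  exact Finset.le_sup' (fun R : Ranking m n => ∑ t, μ (R t) * v t)
    (Finset.mem_univ ((Fin.castLEEmb hn).trans (descPerm μ).toEmbedding))

lemma measurable_bestValue (hn : n ≤ m) {v : Fin n → ℝ} (hv : ∀ t, 0 ≤ v t) (hanti : Antitone v) :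
    Measurable fun μ : Fin m → ℝ => bestValue hn μ v := by
  rw [bestValue_eq_sup hn hv hanti]
  exact Finset.measurable_sup' _ fun R _ => by fun_prop

lemma integrable_bestValue (hn : n ≤ m) {v : Fin n → ℝ} (hv : ∀ t, 0 ≤ v t) (hanti : Antitone v)
    {S : ℝ} (hS : 0 < S) : Integrable (fun μ => bestValue hn μ v) (meansLaw m S) := by
  have := isProbabilityMeasure_meansLaw m hS
  refine Integrable.of_bound (measurable_bestValue hn hv hanti).aestronglyMeasurable
    (S * ∑ t, v t) ?_
  filter_upwards [ae_mem_Icc_meansLaw m hS] with μ hμ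
  rw [Real.norm_of_nonneg (bestValue_nonneg hn hv fun t => (hμ _).1), Finset.mul_sum]
  exact Finset.sum_le_sum fun t _ => mul_le_mul_of_nonneg_right (hμ _).2 (hv t)

lemma integrable_algorithm_value {v : Fin n → ℝ} (hv : ∀ t, 0 ≤ v t) {S : ℝ} (hS : 0 < S)
    {Alg : (Fin m → ℝ) → Ranking m n → ℝ} (hm : ∀ R, Measurable fun μ => Alg μ R)
    (hAlg : ∀ᵐ μ ∂(meansLaw m S), Alg μ ∈ stdSimplex ℝ (Ranking m n)) :
    Integrable (fun μ => ∑ R, Alg μ R * ∑ t, μ (R t) * v t) (meansLaw m S) := by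
  have := isProbabilityMeasure_meansLaw m hS
  have hmeas : Measurable fun μ : Fin m → ℝ => ∑ R, Alg μ R * ∑ t, μ (R t) * v t :=
    Finset.measurable_sum _ fun R _ => (hm R).mul (by fun_prop)
  refine Integrable.of_bound hmeas.aestronglyMeasurable (S * ∑ t, v t) ?_
  filter_upwards [ae_mem_Icc_meansLaw m hS, hAlg] with μ hμ hA
  have h0 : ∀ R : Ranking m n, 0 ≤ ∑ t, μ (R t) * v t := fun R =>
    Finset.sum_nonneg fun t _ => mul_nonneg (hμ _).1 (hv t)
  rw [Real.norm_of_nonneg (Finset.sum_nonneg fun R _ => mul_nonneg (hA.1 R) (h0 R))]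
  calc ∑ R, Alg μ R * ∑ t, μ (R t) * v t ≤ ∑ R, Alg μ R * (S * ∑ t, v t) := by
        refine Finset.sum_le_sum fun R _ => mul_le_mul_of_nonneg_left ?_ (hA.1 R)
        rw [Finset.mul_sum]
        exact Finset.sum_le_sum fun t _ => mul_le_mul_of_nonneg_right (hμ _).2 (hv t)
    _ = S * ∑ t, v t := by rw [← Finset.sum_mul, hA.2, one_mul]

lemma mul_sum_le_integral_bestValue (hn : n ≤ m) {v : Fin n → ℝ} (hv : ∀ t, 0 ≤ v t)
    (hanti : Antitone v) {S θ : ℝ} (hS : 0 < S) (hθ : 0 ≤ θ)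
    (hP : 1 / 2 ≤ (meansLaw m S).real (largeMeans m n θ)) :
    θ / 2 * ∑ t, v t ≤ ∫ μ, bestValue hn μ v ∂(meansLaw m S) := by
  have := isProbabilityMeasure_meansLaw m hS
  have hV : 0 ≤ ∑ t, v t := Finset.sum_nonneg fun t _ => hv t
  have hms := measurableSet_largeMeans m n θ
  calc θ / 2 * ∑ t, v t = 1 / 2 * (θ * ∑ t, v t) := by ring
    _ ≤ (meansLaw m S).real (largeMeans m n θ) * (θ * ∑ t, v t) :=
        mul_le_mul_of_nonneg_right hP (by positivity)
    _ = ∫ μ, (largeMeans m n θ).indicator (fun _ => θ * ∑ t, v t) μ ∂(meansLaw m S) := by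
        rw [integral_indicator_const _ hms, smul_eq_mul]
    _ ≤ _ := by
        refine integral_mono_ae ((integrable_const _).indicator hms)
          (integrable_bestValue hn hv hanti hS) ?_
        filter_upwards [ae_mem_Icc_meansLaw m hS] with μ hμ
        by_cases h : μ ∈ largeMeans m n θ
        · simpa [h] using mul_sum_le_bestValue hn hv (le_desc_of_mem_largeMeans hn h)
        · simpa [h] using bestValue_nonneg hn hv fun t => (hμ _).1

/-- The additive bounds hold for almost every `μ` and are integrated before being compared, so only
the average of `bestValue` must be large. Means with small top values thus need no relative
guarantee of their own. -/
lemma alphaBound_mul_integral_le (hn : n ≤ m) (hm : 0 < m) {lay : Layout m n p q}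
    {v : Fin n → ℝ} (hv : ∀ t, 0 ≤ v t) (hanti : Antitone v) {σ : Fin m → ℝ≥0}
    {A : Matrix (Fin m) (Fin q) ℝ} {S c K : ℝ}
    (hS : 0 < S) (hc : 0 < c) (hcm : (n : ℝ) ≤ (1 - c) * m) (hK : 31 ≤ K)
    (hKc : 31 ≤ K * (c / 4)) (hK2 : 2 * (1 / c ^ 2) ≤ K)
    {L U : (Fin m → ℝ) → Matrix (Fin q) (Fin p) ℤ}
    {Alg : (Fin m → ℝ) → Ranking m n → ℝ}
    {Dstar : (Fin m → ℝ) → (Fin m → ℝ) → Ranking m n → ℝ}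
    (hAlgm : ∀ R, Measurable fun μ => Alg μ R)
    (hAlg : ∀ᵐ μ ∂(meansLaw m S),
      ∃ run : AlgRun lay (L μ) (U μ) (rankProb lay μ σ) A μ v, Alg μ = run.law)
    (hD : ∀ᵐ μ ∂(meansLaw m S), ∀ ρ,
      IsOptimalFair lay (L μ) (U μ) (rankProb lay μ σ) A ρ v (Dstar μ ρ)) :
    alphaBound K σ S * ∫ μ, ∫ ρ, expUtility ρ v (Dstar μ ρ) ∂(utilityLaw μ σ) ∂(meansLaw m S) ≤
      ∫ μ, ∫ ρ, expUtility ρ v (Alg μ) ∂(utilityLaw μ σ) ∂(meansLaw m S) := by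
  have := isProbabilityMeasure_meansLaw m hS
  have hIcc := ae_mem_Icc_meansLaw m hS
  rcases le_or_gt (alphaBound K σ S) 0 with hneg | hpos
  · have h1 : 0 ≤ ∫ μ, ∫ ρ, expUtility ρ v (Dstar μ ρ) ∂(utilityLaw μ σ) ∂(meansLaw m S) := by
      refine integral_nonneg_of_ae ?_
      filter_upwards [hIcc, hAlg, hD] with μ hμ ⟨run, _⟩ hDμ
      exact run.integral_optimal_nonneg hv (fun i => (hμ i).1) hDμ
    have h2 : 0 ≤ ∫ μ, ∫ ρ, expUtility ρ v (Alg μ) ∂(utilityLaw μ σ) ∂(meansLaw m S) := by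
      refine integral_nonneg_of_ae ?_
      filter_upwards [hIcc, hAlg] with μ hμ ⟨run, hrun⟩
      rw [hrun]
      exact run.integral_expUtility_nonneg hv fun i => (hμ i).1
    exact (mul_nonpos_of_nonpos_of_nonneg hneg h1).trans h2
  · have hm2 := two_le_of_alphaBound_pos (by linarith) hm hpos
    have hV : 0 ≤ ∑ t, v t := Finset.sum_nonneg fun t _ => hv t
    have hs0 : 0 ≤ sigmaMax σ := NNReal.coe_nonneg _
    have hα := hpos
    rw [alphaBound_eq] at hα
    have hy0 : 0 ≤ (m : ℝ) ^ (-(1 / 4) : ℝ) := by positivity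
    have hx0 : 0 ≤ K * (sigmaMax σ * √(Real.log m)) / S := by positivity
    -- Positivity of α forces K m^(-1/4) < 1, and K ≥ 2/c² then leaves a failure probability below
    -- 1/2.
    have hP : 1 / 2 ≤ (meansLaw m S).real (largeMeans m n (c / 2 * S)) := by
      refine le_trans ?_ (one_sub_le_largeMeans hm hc hcm hS)
      have := mul_le_mul_of_nonneg_right hK2 hy0
      linarith
    have hB := mul_sum_le_integral_bestValue hn hv hanti hS (by positivity) hP
    have hBint := integrable_bestValue hn hv hanti hS
    refine alpha_mul_le_of_bounds (B := ∫ μ, bestValue hn μ v ∂(meansLaw m S)) (V := ∑ t, v t)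
      (c := c / 4) hS (by positivity : 0 ≤ sigmaMax σ * √(Real.log m)) hy0 hV
      (by positivity) hK hKc hpos.le (alphaBound_eq K σ S).le (le_trans (le_of_eq (by ring)) hB)
      ?_ ?_
    · refine integral_le_of_le (g := fun μ => bestValue hn μ v +
        9 * (∑ t, v t) * (sigmaMax σ * √(Real.log m))) (hBint.add (integrable_const _)) ?_ ?_ ?_
      · filter_upwards [hIcc, hD] with μ hμ hDμ
        exact integral_expUtility_le hn hm2 μ σ hv hanti (fun t => (hμ _).1)
          fun ρ => (hDμ ρ).1.distribution
      · have : 0 ≤ c / 2 * S / 2 * ∑ t, v t := by positivity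
        have h9 : 0 ≤ 9 * (∑ t, v t) * (sigmaMax σ * √(Real.log m)) := by positivity
        linarith
      · rw [integral_add hBint (integrable_const _)]
        simp
    · have hAint := integrable_algorithm_value hv hS hAlgm (by
        filter_upwards [hAlg] with μ ⟨run, hrun⟩
        rw [hrun]
        exact run.isFair_law.distribution)
      simp only [(expUtility_integral _ σ v).2]
      have hlow : (∫ μ, bestValue hn μ v ∂(meansLaw m S)) * (1 - 4 * (m : ℝ) ^ (-(1 / 4) : ℝ)) -
          22 * (∑ t, v t) * (sigmaMax σ * √(Real.log m)) =
          ∫ μ, (bestValue hn μ v * (1 - 4 * (m : ℝ) ^ (-(1 / 4) : ℝ)) -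
          22 * (∑ t, v t) * (sigmaMax σ * √(Real.log m))) ∂(meansLaw m S) := by
        rw [integral_sub (hBint.mul_const _) (integrable_const _), integral_mul_const]
        simp
      rw [hlow]
      refine integral_mono_ae ((hBint.mul_const _).sub (integrable_const _)) hAint ?_
      filter_upwards [hIcc, hAlg] with μ hμ ⟨run, hrun⟩
      have := run.bestValue_sub_le hn hm2 hv fun t => (hμ _).1
      rwa [(expUtility_integral μ σ v).2, ← hrun] at this

end FairRanking

end

theorem mainTheorem3 :
    -- The algorithm can be run on every instance that has a fair distribution, with `O(n² m²)`
    -- matchings, and the output is always fair; the guarantee for deterministic means.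
    (∃ K : ℝ, 0 < K ∧
      ∀ (m n p q : ℕ) (_ : 0 < n) (_ : n ≤ m) (lay : Layout m n p q)
        (v : Fin n → ℝ) (_ : ∀ t, 0 < v t) (_ : Antitone v)
        (σ : Fin m → ℝ≥0) (μ : Fin m → ℝ) (L U : Matrix (Fin q) (Fin p) ℤ),
        ((∃ D, IsFair lay L U (rankProb lay μ σ) (allOnes m q) D) →
          ∃ run : AlgRun lay L U (rankProb lay μ σ) (allOnes m q) μ v,
            (run.T : ℝ) ≤ K * (n : ℝ) ^ 2 * (m : ℝ) ^ 2) ∧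
        (∀ run : AlgRun lay L U (rankProb lay μ σ) (allOnes m q) μ v,
          IsFair lay L U (rankProb lay μ σ) (allOnes m q) run.law ∧
          ∀ μn : ℝ, IsKthLargest μ n μn → 0 < μn → 0 < alphaBound K σ μn →
            ∀ Dstar : (Fin m → ℝ) → Ranking m n → ℝ,
              (∀ ρ, IsOptimalFair lay L U (rankProb lay μ σ) (allOnes m q) ρ v (Dstar ρ)) →
              alphaBound K σ μn * ∫ ρ, expUtility ρ v (Dstar ρ) ∂(utilityLaw μ σ)
                ≤ ∫ ρ, expUtility ρ v run.law ∂(utilityLaw μ σ))) ∧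
    -- The guarantee for i.i.d. means, uniform on `[0, S]`.
    (∀ c : ℝ, 0 < c → ∃ K : ℝ, 0 < K ∧
      ∀ (m n p q : ℕ) (_ : 0 < n) (_ : (n : ℝ) ≤ (1 - c) * m) (lay : Layout m n p q)
        (v : Fin n → ℝ) (_ : ∀ t, 0 < v t) (_ : Antitone v)
        (σ : Fin m → ℝ≥0) (S : ℝ) (_ : 0 < S),
        -- in expectation over the means, the utilities and the rankings
        (∀ (L U : (Fin m → ℝ) → Matrix (Fin q) (Fin p) ℤ)
          (Alg : (Fin m → ℝ) → Ranking m n → ℝ)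
          (Dstar : (Fin m → ℝ) → (Fin m → ℝ) → Ranking m n → ℝ),
          (∀ R, Measurable fun μ => Alg μ R) →
          (∀ R, Measurable fun x : (Fin m → ℝ) × (Fin m → ℝ) => Dstar x.1 x.2 R) →
          (∀ᵐ μ ∂(meansLaw m S),
            ∃ run : AlgRun lay (L μ) (U μ) (rankProb lay μ σ) (allOnes m q) μ v,
              Alg μ = run.law) →
          (∀ᵐ μ ∂(meansLaw m S), ∀ ρ,
            IsOptimalFair lay (L μ) (U μ) (rankProb lay μ σ) (allOnes m q) ρ v (Dstar μ ρ)) →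
          alphaBound K σ S *
              ∫ μ, ∫ ρ, expUtility ρ v (Dstar μ ρ) ∂(utilityLaw μ σ) ∂(meansLaw m S)
            ≤ ∫ μ, ∫ ρ, expUtility ρ v (Alg μ) ∂(utilityLaw μ σ) ∂(meansLaw m S)) ∧
        -- with high probability over the means
        (∃ good : Set (Fin m → ℝ), MeasurableSet good ∧
          1 - K * (m : ℝ) ^ (-(1 / 4) : ℝ) ≤ (meansLaw m S).real good ∧
          ∀ μ ∈ good, ∀ (L U : Matrix (Fin q) (Fin p) ℤ)
            (run : AlgRun lay L U (rankProb lay μ σ) (allOnes m q) μ v)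
            (Dstar : (Fin m → ℝ) → Ranking m n → ℝ),
            (∀ ρ, IsOptimalFair lay L U (rankProb lay μ σ) (allOnes m q) ρ v (Dstar ρ)) →
            alphaBound K σ S * ∫ ρ, expUtility ρ v (Dstar ρ) ∂(utilityLaw μ σ)
              ≤ ∫ ρ, expUtility ρ v run.law ∂(utilityLaw μ σ))) := by

  -- The term 124/c serves the average bound, where the threshold cS/2 is halved again to cS/4; 2/c²
  -- makes large means have probability at least 1/2.
  refine ⟨⟨31, by norm_num, ?_⟩, fun c hc => ⟨124 / c + 2 * (1 / c ^ 2) + 31, by positivity, ?_⟩⟩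
  · intro m n p q hn0 hn lay v hv hanti σ μ L U
    refine ⟨fun ⟨D, hD⟩ => ?_, fun run => ⟨run.isFair_law, ?_⟩⟩
    · obtain ⟨run, hT⟩ := exists_algRun hn v hD
      refine ⟨run, ?_⟩
      have h1 : run.T ≤ 31 * n ^ 2 * m ^ 2 := by
        have hnm : 1 ≤ n * m := Nat.mul_pos hn0 (by omega)
        have hq := Nat.mul_le_mul_left m lay.card_blocks_le
        nlinarith
      exact_mod_cast h1
    · intro μn hkth hμn hpos Dstar hD
      exact run.alphaBound_mul_le hn (by omega) (fun t => (hv t).le) hanti hμn one_pos (by norm_num)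
        (by norm_num) (fun t => by simpa using le_desc_of_isKthLargest hn hkth t) hpos hD
  · intro m n p q hn0 hcm lay v hv hanti σ S hS
    set K := 124 / c + 2 * (1 / c ^ 2) + 31 with hKdef
    have hm : 0 < m := by
      rcases Nat.eq_zero_or_pos m with rfl | h
      · simp at hcm
        omega
      · exact h
    have hn : n ≤ m := by
      have hm' : (0 : ℝ) < m := by exact_mod_cast hm
      have : (n : ℝ) ≤ m := by nlinarith
      exact_mod_cast this
    have hv' : ∀ t, 0 ≤ v t := fun t => (hv t).le
    have hc1 : 0 < 124 / c := by positivity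
    have hc2 : 0 < 1 / c ^ 2 := by positivity
    have hK : 31 ≤ K := by linarith
    have hKc : 124 ≤ K * c := by
      have h := mul_le_mul_of_nonneg_right (by linarith : 124 / c ≤ K) hc.le
      rwa [div_mul_cancel₀ _ hc.ne'] at h
    refine ⟨fun L U Alg Dstar hAlgm _ hAlg hD =>
      alphaBound_mul_integral_le hn hm hv' hanti hS hc hcm hK (by linarith) (by linarith)
        hAlgm hAlg hD, ?_⟩
    have := isProbabilityMeasure_meansLaw m hS
    -- Nonnegativity of all means costs no probability and is needed when α is nonpositive, to give
    -- both values the right sign.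
    refine ⟨largeMeans m n (c / 2 * S) ∩ ⋂ i, {μ | 0 ≤ μ i},
      (measurableSet_largeMeans m n _).inter (MeasurableSet.iInter fun i =>
        measurableSet_le measurable_const (measurable_pi_apply i)), ?_, ?_⟩
    · have hae : largeMeans m n (c / 2 * S) =ᵐ[meansLaw m S]
          (largeMeans m n (c / 2 * S) ∩ ⋂ i, {μ : Fin m → ℝ | 0 ≤ μ i} : Set (Fin m → ℝ)) := by
        filter_upwards [ae_mem_Icc_meansLaw m hS] with μ hμ
        refine propext ⟨fun h => ⟨h, Set.mem_iInter.mpr fun i => (hμ i).1⟩, fun h => h.1⟩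
      rw [← measureReal_congr hae]
      refine le_trans ?_ (one_sub_le_largeMeans hm hc hcm hS)
      have hy0 : 0 ≤ (m : ℝ) ^ (-(1 / 4) : ℝ) := by positivity
      have := mul_le_mul_of_nonneg_right (by linarith : 1 / c ^ 2 ≤ K) hy0
      linarith
    · intro μ ⟨hlarge, hnonneg⟩ L U run Dstar hD
      have hμ0 : ∀ i, 0 ≤ μ i := fun i => Set.mem_iInter.mp hnonneg i
      rcases le_or_gt (alphaBound K σ S) 0 with hneg | hpos
      · exact (mul_nonpos_of_nonpos_of_nonneg hneg (run.integral_optimal_nonneg hv' hμ0 hD)).trans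
          (run.integral_expUtility_nonneg hv' hμ0)
      · exact run.alphaBound_mul_le hn hm hv' hanti hS (half_pos hc) hK (by linarith)
          (le_desc_of_mem_largeMeans hn hlarge) hpos hD
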